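/- Let $\Lambda\subset\mathbb C$ be a lattice with basic periods $2\omega_1,2\omega_3$ ($\mathbb R$-linearly independent), and put $\omega_0=0$, $\omega_2=-\omega_1-\omega_3$. Let $\wp$ be its Weierstrass function, $e_i=\wp(\omega_i)$ $(i=1,2,3)$, and let $D=\{x\in\mathbb C: 2x\notin\Lambda\}$ be the complement of all translates $\omega_i+\Lambda$ $(i=0,\dots,3)$. For $l=(l_0,l_1,l_2,l_3)\in\mathbb C^4$ let $$H^{(l_0,l_1,l_2,l_3)}=-\frac{d^2}{dx^2}+\sum_{i=0}^3 l_i(l_i+1)\,\wp(x+\omega_i).$$ For each $i$ let $\alpha_i\in\{-l_i,\,l_i+1\}$, and suppose that $d=-\sum_{i=0}^3\alpha_i/2$ is a non-negative integer. Let $V_\alpha=V_{\alpha_0,\alpha_1,\alpha_2,\alpha_3}$ be the space spanned by $$(\wp(x)-e_1)^{\alpha_1/2}(\wp(x)-e_2)^{\alpha_2/2}(\wp(x)-e_3)^{\alpha_3/2}\,\wp(x)^n,\qquad n=0,\dots,d,$$ for holomorphic branches of the powers on open subsets of $D$. Write $H=H^{(l_0,l_1,l_2,l_3)}$, $H'=H^{(\alpha_0+d,\alpha_1+d,\alpha_2+d,\alpha_3+d)}$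 and $-\alpha-d=(-\alpha_0-d,\dots,-\alpha_3-d)$. Then: (1) $H$ preserves $V_\alpha$. (2) There is exactly one monic differential operator $L_\alpha=(d/dx)^{d+1}+\sum_{k\le d}a_k(x)(d/dx)^k$ of order $d+1$, with coefficients holomorphic on $D$, that annihilates $V_\alpha$. Its coefficients are meromorphic on $\mathbb C$ and doubly periodic with respect to $\Lambda$. (3) It intertwines the two Hamiltonians: $H'L_\alpha=L_\alpha H$ (as operators on holomorphic functions on open subsets of $D$). (4) $H$ and $H'$ are isomonodromic by means of $L_\alpha$, in the following sense. If $E\in\mathbb C$ is not an eigenvalue of $H$ on $V_\alpha$ and $f_1,f_2$ is a basis of the local solutions of $Hf=Ef$ near a point $x_0\in D$, then $L_\alpha f_1,L_\alpha f_2$ is a basis of the local solutions of $H'f=Ef$ near $x_0$. Moreover, for every $\omega\in\Lambda$ and every path in $D$ from $x_0$ to $x_0+\omega$, a matrix $A$ satisfies $(f_1(x+\omega)\ f_2(x+\omega))=(f_1(x)\ f_2(x))A$, with $f_j(x+\omega)$ obtained by analytic continuation along the path, if and only if $(L_\alpha f_1(x+\omega)\ L_\alpha f_2(x+\omega))=(L_\alpha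 f_1(x)\ L_\alpha f_2(x))A$ in the same sense. Finally, for the remaining finitely many values, $E\in\mathbb C$ is an eigenvalue of $H$ on $V_\alpha$ if and only if it is an eigenvalue of $H'$ on $V_{-\alpha-d}$. -/

import Mathlib

open Filter Topology

noncomputable section

namespace Heun

/-- The half-periods `ω₀ = 0, ω₁, ω₂, ω₃`, where the two basic periods of `Λ` are `2ω₁` and `2ω₃`,
and `ω₂ = -ω₁ - ω₃`. -/
def halfPeriod (Λ : PeriodPair) : Fin 4 → ℂ :=
  ![0, Λ.ω₁ / 2, -(Λ.ω₁ / 2) - Λ.ω₂ / 2, Λ.ω₂ / 2]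

/-- The complement of the set of all points congruent to some `ωᵢ` modulo the period lattice. -/
def regularSet (Λ : PeriodPair) : Set ℂ := {x | 2 * x ∉ Λ.lattice}

/-- The Treibich–Verdier potential `∑ᵢ lᵢ (lᵢ + 1) ℘(x + ωᵢ)`. -/
def potential (Λ : PeriodPair) (l : Fin 4 → ℂ) (x : ℂ) : ℂ :=
  ∑ i, l i * (l i + 1) * Λ.weierstrassP (x + halfPeriod Λ i)

/-- The operator `H^{(l₀,l₁,l₂,l₃)} = -d²/dx² + ∑ᵢ lᵢ (lᵢ + 1) ℘(x + ωᵢ)`. -/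
def hamiltonian (Λ : PeriodPair) (l : Fin 4 → ℂ) (f : ℂ → ℂ) (x : ℂ) : ℂ :=
  -iteratedDeriv 2 f x + potential Λ l x * f x

/-- A monic ordinary differential operator
`(d/dx)ⁿ + ∑_{k < n} coeff k · (d/dx)ᵏ` with coefficients holomorphic on `D`. -/
structure MonicDiffOp (D : Set ℂ) (n : ℕ) where
  /-- The coefficient of `(d/dx)ᵏ`; its values outside `D` are irrelevant. -/
  coeff : Fin n → ℂ → ℂ
  analytic : ∀ k, AnalyticOnNhd ℂ (coeff k) D

/-- The action of a monic differential operator on a function. -/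
def MonicDiffOp.act {D : Set ℂ} {n : ℕ} (L : MonicDiffOp D n) (f : ℂ → ℂ) (x : ℂ) : ℂ :=
  iteratedDeriv n f x + ∑ k : Fin n, L.coeff k x * iteratedDeriv (k : ℕ) f x

/-- `Φ` is, on `U`, a holomorphic branch of
`(℘ - e₁)^{α₁/2} (℘ - e₂)^{α₂/2} (℘ - e₃)^{α₃/2}`, where `eᵢ = ℘(ωᵢ)`:
here `g i` is a holomorphic branch on `U` of the logarithm of `℘ - e_{i+1}`. -/
def IsBranch (Λ : PeriodPair) (α : Fin 4 → ℂ) (U : Set ℂ) (Φ : ℂ → ℂ) : Prop :=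
  ∃ g : Fin 3 → ℂ → ℂ,
    (∀ i, AnalyticOnNhd ℂ (g i) U) ∧
    (∀ i, ∀ x ∈ U,
      Complex.exp (g i x) = Λ.weierstrassP x - Λ.weierstrassP (halfPeriod Λ i.succ)) ∧
    ∀ x ∈ U, Φ x = ∏ i : Fin 3, Complex.exp (α i.succ / 2 * g i x)

/-- The space `V` spanned by `Φ ℘ⁿ`, `n = 0, …, d`, for a given branch `Φ`. -/
def quasiSolvableSpace (Λ : PeriodPair) (d : ℕ) (Φ : ℂ → ℂ) : Submodule ℂ (ℂ → ℂ) :=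
  Submodule.span ℂ
    (Set.range fun (n : Fin (d + 1)) (x : ℂ) => Φ x * Λ.weierstrassP x ^ (n : ℕ))

/-- The operator `H^{(l)}` preserves `V_α`, for every local branch. -/
def PreservesSpace (Λ : PeriodPair) (l α : Fin 4 → ℂ) (d : ℕ) : Prop :=
  ∀ (U : Set ℂ) (Φ : ℂ → ℂ), IsOpen U → U ⊆ regularSet Λ → IsBranch Λ α U Φ →
    ∀ f ∈ quasiSolvableSpace Λ d Φ, ∃ h ∈ quasiSolvableSpace Λ d Φ,
      Set.EqOn (hamiltonian Λ l f) h U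

/-- The operator `L` annihilates `V_α`, for every local branch. -/
def AnnihilatesSpace (Λ : PeriodPair) (α : Fin 4 → ℂ) (d : ℕ) {n : ℕ}
    (L : MonicDiffOp (regularSet Λ) n) : Prop :=
  ∀ (U : Set ℂ) (Φ : ℂ → ℂ), IsOpen U → U ⊆ regularSet Λ → IsBranch Λ α U Φ →
    ∀ f ∈ quasiSolvableSpace Λ d Φ, ∀ x ∈ U, L.act f x = 0

/-- `E` is an eigenvalue of `H^{(l)}` on `V_α`. -/
def IsEigenvalueOnSpace (Λ : PeriodPair) (l α : Fin 4 → ℂ) (d : ℕ) (E : ℂ) : Prop :=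
  ∃ (U : Set ℂ) (Φ : ℂ → ℂ), IsOpen U ∧ IsConnected U ∧ U ⊆ regularSet Λ ∧ IsBranch Λ α U Φ ∧
    ∃ f ∈ quasiSolvableSpace Λ d Φ, (∃ x ∈ U, f x ≠ 0) ∧
      ∀ x ∈ U, hamiltonian Λ l f x = E * f x

/-- `f` is a holomorphic solution of `H^{(l)} f = E f` near `x₀`. -/
def IsSolutionAt (Λ : PeriodPair) (l : Fin 4 → ℂ) (E x₀ : ℂ) (f : ℂ → ℂ) : Prop :=
  AnalyticAt ℂ f x₀ ∧ ∀ᶠ x in 𝓝 x₀, hamiltonian Λ l f x = E * f x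

/-- `f 0, f 1` is a basis of the space of germs at `x₀` of solutions of `H^{(l)} f = E f`. -/
def IsSolutionBasisAt (Λ : PeriodPair) (l : Fin 4 → ℂ) (E x₀ : ℂ) (f : Fin 2 → ℂ → ℂ) : Prop :=
  (∀ i, IsSolutionAt Λ l E x₀ (f i)) ∧
    ∀ h, IsSolutionAt Λ l E x₀ h →
      ∃! a : Fin 2 → ℂ, h =ᶠ[𝓝 x₀] fun x => ∑ i, a i * f i x

/-- Analytic continuation along the path `γ` carries the germ of `f` at the initial point `a`
to the germ of `h` at the end point `b`. -/
def ContinuesAlong {a b : ℂ} (γ : Path a b) (f h : ℂ → ℂ) : Prop :=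
  ∃ F : unitInterval → ℂ → ℂ,
    (∀ t, AnalyticAt ℂ (F t) (γ t)) ∧
    (∀ t, ∀ᶠ s in 𝓝 t, F s =ᶠ[𝓝 (γ s)] F t) ∧
    F 0 =ᶠ[𝓝 a] f ∧ F 1 =ᶠ[𝓝 b] h

/-- `(f₁(x + ω), f₂(x + ω)) = (f₁(x), f₂(x)) A` for `x` near `x₀`, where `fⱼ(x + ω)` is obtained
by analytic continuation along the path `γ` from `x₀` to `x₀ + ω`. -/
def IsMonodromyMatrix {x₀ ω : ℂ} (γ : Path x₀ (x₀ + ω)) (f : Fin 2 → ℂ → ℂ)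
    (A : Matrix (Fin 2) (Fin 2) ℂ) : Prop :=
  ∀ j, ContinuesAlong γ (f j) fun y => ∑ i, f i (y - ω) * A i j

/-- `L` carries every basis of local solutions of `H^{(l)} f = E f` to a basis of local solutions
of `H^{(l')} f = E f` with the same monodromy matrices along all paths joining two points of
the regular set that differ by a period. -/
def IsIsomonodromicAt (Λ : PeriodPair) (l l' : Fin 4 → ℂ) {n : ℕ}
    (L : MonicDiffOp (regularSet Λ) n) (E : ℂ) : Prop :=
  ∀ x₀ ∈ regularSet Λ, ∀ f : Fin 2 → ℂ → ℂ, IsSolutionBasisAt Λ l E x₀ f →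
    IsSolutionBasisAt Λ l' E x₀ (fun i => L.act (f i)) ∧
    ∀ ω ∈ Λ.lattice, ∀ γ : Path x₀ (x₀ + ω), (∀ t, γ t ∈ regularSet Λ) →
      ∀ A : Matrix (Fin 2) (Fin 2) ℂ,
        IsMonodromyMatrix γ f A ↔ IsMonodromyMatrix γ (fun i => L.act (f i)) A

end Heun

end

open Filter Topology

noncomputable section

namespace Heun

/-! ### The half-period formula for `℘`, by Liouville's theorem. -/

section HalfPeriod

variable {Λ : PeriodPair} {h : ℂ}

/-! Let `Φ = ∏ (℘ - eᵢ)^{αᵢ/2}`, `χ = Φ'/Φ`, `s = α₁ + α₂ + α₃` and `m = α₀(α₀ - 1)`. A Riccati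
identity (`sum_shiftP_eq_riccati`) gives `H = -(d/dx + χ)(d/dx - χ) + (m - s² - s)℘ + const`.
Exchanging the two factors raises each of `α₁, α₂, α₃` by one. So `d/dx - χ` intertwines `H` with an
operator of the same shape, up to a multiple of `℘'` (`lower_ladderHam`).

Since `℘'² = 4 ∏ (℘ - eᵢ)`, multiplication by `℘'` also raises these exponents by one. Hence the
product of `n` successive factors `d/dx - χₖ` sends `Φ p(℘)` to `Φ ℘'ⁿ p⁽ⁿ⁾(℘)`. For `n = d + 1` its
kernel is `V_α`, so this product is `L_α`. The errors add up to one term (`ladder_ladderHam`), whose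
coefficient vanishes at `n = d + 1` precisely because `s + 2d = -α₀`; this is `intertwining`. The
same relation stops `H` from raising the degree in `℘` above `d`, whence `V_α` is preserved.

On solutions of `Hf = Ef`, `L_α` reduces to a first order operator `a f + b f'` with periodic
coefficients. Its determinant on `(f, f')` is a quotient of Wronskians, hence constant, and it is
nonzero unless some solution lies in `V_α`. The inverse is then also a first order operator with
periodic coefficients, and both directions respect continuation and translation
(`isMonodromyMatrix_act_iff`).

In the basis `Φ (℘ - e₁)ⁿ` the matrix of `H` on `V_α` is tridiagonal. Reversing the basis,
transposing and conjugating by a diagonal matrix turns it into the matrix of `H'` on `V_{-α-d}`, so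
the exceptional values agree (`isEigenvalueOnSpace_iff_dual`). -/

lemma weierstrassP_add_of_mem (Λ : PeriodPair) (z : ℂ) {w : ℂ} (hw : w ∈ Λ.lattice) :
    Λ.weierstrassP (z + w) = Λ.weierstrassP z :=
  Λ.weierstrassP_add_coe z ⟨w, hw⟩

lemma derivWeierstrassP_add_of_mem (Λ : PeriodPair) (z : ℂ) {w : ℂ} (hw : w ∈ Λ.lattice) :
    Λ.derivWeierstrassP (z + w) = Λ.derivWeierstrassP z :=
  Λ.derivWeierstrassP_add_coe z ⟨w, hw⟩

lemma add_mem_lattice_iff_left {x w : ℂ} (hw : w ∈ Λ.lattice) :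
    x + w ∈ Λ.lattice ↔ x ∈ Λ.lattice :=
  ⟨fun H => by simpa using Λ.lattice.sub_mem H hw, fun H => Λ.lattice.add_mem H hw⟩

lemma derivWeierstrassP_halfPeriod (hh : 2 * h ∈ Λ.lattice) : Λ.derivWeierstrassP h = 0 := by
  have h1 := derivWeierstrassP_add_of_mem Λ (-h) hh
  rw [show -h + 2 * h = h by ring, Λ.derivWeierstrassP_neg] at h1
  linear_combination h1 / 2

lemma hasDerivAt_weierstrassP {x : ℂ} (hx : x ∉ Λ.lattice) :
    HasDerivAt Λ.weierstrassP (Λ.derivWeierstrassP x) x := by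
  rw [← Λ.deriv_weierstrassP]
  exact (Λ.analyticOnNhd_weierstrassP x hx).differentiableAt.hasDerivAt

/-- Near a pole, `(℘(x) - ℘(h)) (℘(x + h) - ℘(h))` has a removable singularity. -/
lemma exists_analyticAt_eq_mul_shift (hh : 2 * h ∈ Λ.lattice) (hn : h ∉ Λ.lattice) :
    ∃ k : ℂ → ℂ, AnalyticAt ℂ k 0 ∧ ∀ᶠ x in 𝓝[≠] 0,
      (Λ.weierstrassP x - Λ.weierstrassP h) * (Λ.weierstrassP (x + h) - Λ.weierstrassP h)
        = k x := by
  have hq : AnalyticAt ℂ (fun x => Λ.weierstrassP (x + h) - Λ.weierstrassP h) 0 := by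
    have := (Λ.analyticOnNhd_weierstrassP (0 + h) (by simpa using hn)).fun_comp
      (f := fun x : ℂ => x + h) (by fun_prop)
    exact this.sub analyticAt_const
  -- The second factor has a double zero at `0` because `℘'(h) = 0`; it cancels the double pole of
  -- `℘`.
  have hord : (2 : ℕ) ≤ analyticOrderAt
      (fun x => Λ.weierstrassP (x + h) - Λ.weierstrassP h) 0 := by
    rw [natCast_le_analyticOrderAt_iff_iteratedDeriv_eq_zero hq]
    intro i hi
    interval_cases i
    · simp
    · rw [iteratedDeriv_one]
      have : HasDerivAt (fun x => Λ.weierstrassP (x + h) - Λ.weierstrassP h)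
          (Λ.derivWeierstrassP (0 + h)) 0 :=
        ((hasDerivAt_weierstrassP (by simpa using hn)).comp_add_const 0 h).sub_const _
      rw [this.deriv, zero_add, derivWeierstrassP_halfPeriod hh]
  obtain ⟨g, hg, hgeq⟩ := (natCast_le_analyticOrderAt hq).1 hord
  refine ⟨fun x => (x ^ 2 * Λ.weierstrassPExcept 0 x + 1 - Λ.weierstrassP h * x ^ 2) * g x,
    ?_, ?_⟩
  · have := Λ.analyticAt_weierstrassPExcept 0
    fun_prop
  · filter_upwards [self_mem_nhdsWithin, hgeq.filter_mono nhdsWithin_le_nhds] with x hx hgx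
    have hx0 : x ≠ 0 := hx
    rw [hgx]
    have := Λ.weierstrassPExcept_add ⟨0, Λ.lattice.zero_mem⟩ x
    simp only [sub_zero] at this
    rw [← this, smul_eq_mul]
    field_simp
    ring

/-- Liouville: the product is doubly periodic, and its singularities are removable, at lattice
points by the preceding lemma and at their `h`-translates by the symmetry `x ↦ x + h`. -/
lemma exists_mul_shift_eq_const (hh : 2 * h ∈ Λ.lattice) (hn : h ∉ Λ.lattice) :
    ∃ c : ℂ, ∀ x, x ∉ Λ.lattice → x + h ∉ Λ.lattice →
      (Λ.weierstrassP x - Λ.weierstrassP h) * (Λ.weierstrassP (x + h) - Λ.weierstrassP h)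
        = c := by
  classical
  obtain ⟨k, hk, hkeq⟩ := exists_analyticAt_eq_mul_shift hh hn
  -- The same value `k 0` fills both kinds of singular point, which keeps `G` invariant under `x ↦ x
  -- + h`.
  set G : ℂ → ℂ := fun x => if x ∈ Λ.lattice ∨ x + h ∈ Λ.lattice then k 0 else
    (Λ.weierstrassP x - Λ.weierstrassP h) * (Λ.weierstrassP (x + h) - Λ.weierstrassP h) with hG
  have hper : ∀ x, ∀ w ∈ Λ.lattice, G (x + w) = G x := by
    intro x w hw
    have e1 : x + w + h = x + h + w := by ring
    simp only [hG, add_mem_lattice_iff_left hw, e1, weierstrassP_add_of_mem Λ _ hw]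
  have hperh : ∀ x, G (x + h) = G x := by
    intro x
    have e1 : x + h + h = x + 2 * h := by ring
    simp only [hG, e1, add_mem_lattice_iff_left hh, weierstrassP_add_of_mem Λ _ hh]
    split_ifs <;> first | tauto | ring
  have hclosed : ∀ y, y ∉ Λ.lattice → ∀ᶠ x in 𝓝 y, x ∉ Λ.lattice := fun y hy =>
    Λ.isClosed_lattice.isOpen_compl.mem_nhds hy
  have hadd : ∀ y : ℂ, Tendsto (fun x => x + h) (𝓝 y) (𝓝 (y + h)) := fun y =>
    (continuous_id.add continuous_const).tendsto y
  have h0 : AnalyticAt ℂ G 0 := by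
    refine hk.congr ?_
    rw [eventually_nhdsWithin_iff] at hkeq
    have h1 : ∀ᶠ x in 𝓝 (0 : ℂ), x + h ∉ Λ.lattice :=
      (hadd 0).eventually (hclosed _ (by simpa using hn))
    have h2 := Λ.compl_lattice_sdiff_singleton_mem_nhds 0
    filter_upwards [hkeq, h1, h2] with x hx hx1 hx2
    by_cases hx0 : x = 0
    · simp [hG, hx0]
    · have hxl : x ∉ Λ.lattice := fun H => hx2 ⟨H, hx0⟩
      simp only [hG, hxl, hx1, or_self, if_false]
      exact (hx hx0).symm
  have hlat : ∀ w ∈ Λ.lattice, AnalyticAt ℂ G w := by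
    intro w hw
    have h1 : AnalyticAt ℂ (fun x => G (x - w)) w :=
      AnalyticAt.fun_comp (by simpa using h0) (by fun_prop)
    convert h1 using 1
    ext x
    rw [← hper (x - w) w hw, sub_add_cancel]
  have hall : ∀ y, AnalyticAt ℂ G y := by
    intro y
    by_cases hy : y ∈ Λ.lattice
    · exact hlat y hy
    by_cases hy' : y + h ∈ Λ.lattice
    · have h1 : AnalyticAt ℂ (fun x => G (x + h)) y :=
        AnalyticAt.fun_comp (hlat _ hy') (by fun_prop)
      convert h1 using 1
      ext x
      exact (hperh x).symm
    · have h1 : AnalyticAt ℂ (fun x => (Λ.weierstrassP x - Λ.weierstrassP h) *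
          (Λ.weierstrassP (x + h) - Λ.weierstrassP h)) y := by
        have a1 := Λ.analyticOnNhd_weierstrassP y hy
        have a2 : AnalyticAt ℂ (fun x => Λ.weierstrassP (x + h)) y :=
          AnalyticAt.fun_comp (Λ.analyticOnNhd_weierstrassP (y + h) hy') (by fun_prop)
        fun_prop
      refine h1.congr ?_
      filter_upwards [hclosed y hy, (hadd y).eventually (hclosed _ hy')] with x hx hx'
      simp [hG, hx, hx']
  have hd : Differentiable ℂ G := fun y => (hall y).differentiableAt
  refine ⟨G 0, fun x hx hx' => ?_⟩
  rw [← hd.apply_eq_apply_of_bounded (IsZLattice.isCompact_range_of_periodic Λ.lattice _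
    hd.continuous hper).isBounded x 0]
  simp [hG, hx, hx']

end HalfPeriod

/-! ### The values `eᵢ` and the differential equation of `℘`. -/

section RegularSet

variable {Λ : PeriodPair} {x : ℂ}

lemma two_mul_halfPeriod_mem (Λ : PeriodPair) (i : Fin 4) : 2 * halfPeriod Λ i ∈ Λ.lattice := by
  fin_cases i
  · simp [halfPeriod]
  · convert Λ.ω₁_mem_lattice using 1
    simp [halfPeriod]; ring
  · convert Λ.lattice.sub_mem (Λ.lattice.neg_mem Λ.ω₁_mem_lattice) Λ.ω₂_mem_lattice using 1
    simp [halfPeriod]; ring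
  · convert Λ.ω₂_mem_lattice using 1
    simp [halfPeriod]; ring

lemma halfPeriod_succ_notMem (Λ : PeriodPair) (i : Fin 3) :
    halfPeriod Λ i.succ ∉ Λ.lattice := by
  fin_cases i
  · simpa [halfPeriod] using Λ.ω₁_div_two_notMem_lattice
  · have := (Λ.mul_ω₁_add_mul_ω₂_mem_lattice (α := -1 / 2) (β := -1 / 2)).not.mpr (by norm_num)
    convert this using 2
    simp [halfPeriod]; ring
  · simpa [halfPeriod] using Λ.ω₂_div_two_notMem_lattice

lemma halfPeriod_add_add {i j k : Fin 3} (hij : i ≠ j) (hik : i ≠ k) (hjk : j ≠ k) :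
    halfPeriod Λ i.succ + halfPeriod Λ j.succ + halfPeriod Λ k.succ = 0 := by
  fin_cases i <;> fin_cases j <;> fin_cases k <;> simp_all [halfPeriod] <;> ring

lemma halfPeriod_add_notMem {i j : Fin 3} (hij : i ≠ j) :
    halfPeriod Λ i.succ + halfPeriod Λ j.succ ∉ Λ.lattice := by
  obtain ⟨k, hik, hjk⟩ : ∃ k, i ≠ k ∧ j ≠ k := by revert i j; decide
  rw [show halfPeriod Λ i.succ + halfPeriod Λ j.succ = -halfPeriod Λ k.succ by
    linear_combination halfPeriod_add_add (Λ := Λ) hij hik hjk]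
  simpa using halfPeriod_succ_notMem Λ k

lemma add_halfPeriod_notMem (hx : x ∈ regularSet Λ) (i : Fin 4) :
    x + halfPeriod Λ i ∉ Λ.lattice := by
  intro H
  refine hx ?_
  have h2 : 2 * (x + halfPeriod Λ i) ∈ Λ.lattice := by
    rw [two_mul]; exact Λ.lattice.add_mem H H
  rw [mul_add] at h2
  exact (add_mem_lattice_iff_left (two_mul_halfPeriod_mem Λ i)).1 h2

lemma notMem_lattice (hx : x ∈ regularSet Λ) : x ∉ Λ.lattice := by
  simpa [halfPeriod] using add_halfPeriod_notMem hx 0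

lemma add_halfPeriod_mem_regularSet (hx : x ∈ regularSet Λ) (i : Fin 4) :
    x + halfPeriod Λ i ∈ regularSet Λ := by
  change 2 * (x + halfPeriod Λ i) ∉ Λ.lattice
  rwa [mul_add, add_mem_lattice_iff_left (two_mul_halfPeriod_mem Λ i)]

lemma isOpen_regularSet (Λ : PeriodPair) : IsOpen (regularSet Λ) :=
  Λ.isClosed_lattice.isOpen_compl.preimage (continuous_const.mul continuous_id)

/-- Removing a countable set does not disconnect the plane. This makes the identity theorem
available on the whole regular set. -/
lemma isConnected_regularSet (Λ : PeriodPair) : IsConnected (regularSet Λ) := by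
  have hc : (Λ.lattice : Set ℂ).Countable :=
    Set.countable_coe_iff.1 (inferInstanceAs (Countable Λ.lattice))
  have hc' : {x : ℂ | 2 * x ∈ Λ.lattice}.Countable :=
    hc.preimage (f := fun x : ℂ => 2 * x) (mul_right_injective₀ two_ne_zero)
  exact (hc'.isPathConnected_compl_of_one_lt_rank (by simp)).isConnected

lemma eventually_mem_regularSet_nhdsNE_zero (Λ : PeriodPair) :
    ∀ᶠ x in 𝓝[≠] (0 : ℂ), x ∈ regularSet Λ := by
  rw [eventually_nhdsWithin_iff]
  have h := Λ.compl_lattice_sdiff_singleton_mem_nhds 0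
  have ht : Tendsto (fun x : ℂ => 2 * x) (𝓝 0) (𝓝 0) := by
    have : Continuous fun x : ℂ => 2 * x := by fun_prop
    simpa using this.tendsto 0
  filter_upwards [ht h] with x hx hx0 H
  exact hx ⟨H, by simpa using hx0⟩

/-- The value `eᵢ₊₁ = ℘(ωᵢ₊₁)`. -/
def root (Λ : PeriodPair) (i : Fin 3) : ℂ := Λ.weierstrassP (halfPeriod Λ i.succ)

/-- The translate `℘(x + ωᵢ₊₁)`. -/
def shiftP (Λ : PeriodPair) (i : Fin 3) (x : ℂ) : ℂ := Λ.weierstrassP (x + halfPeriod Λ i.succ)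

lemma exists_weierstrassP_ne (Λ : PeriodPair) (c : ℂ) :
    ∃ x ∈ regularSet Λ, Λ.weierstrassP x ≠ c := by
  by_contra! H
  have h1 : Λ.weierstrassP =ᶠ[𝓝[≠] 0] fun _ => c := by
    filter_upwards [eventually_mem_regularSet_nhdsNE_zero Λ] with x hx using H x hx
  have h2 := meromorphicOrderAt_congr h1
  rw [Λ.order_weierstrassP 0 Λ.lattice.zero_mem] at h2
  have h3 : (0 : WithTop ℤ) ≤ meromorphicOrderAt (fun _ : ℂ => c) 0 :=
    analyticAt_const.meromorphicOrderAt_nonneg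
  rw [← h2] at h3
  exact absurd h3 (by decide)

lemma analyticOnNhd_weierstrassP (Λ : PeriodPair) :
    AnalyticOnNhd ℂ Λ.weierstrassP (regularSet Λ) :=
  fun x hx => Λ.analyticOnNhd_weierstrassP x (notMem_lattice hx)

lemma analyticOnNhd_derivWeierstrassP (Λ : PeriodPair) :
    AnalyticOnNhd ℂ Λ.derivWeierstrassP (regularSet Λ) :=
  fun x hx => Λ.analyticOnNhd_derivWeierstrassP x (notMem_lattice hx)

lemma analyticOnNhd_shiftP (Λ : PeriodPair) (i : Fin 3) :
    AnalyticOnNhd ℂ (shiftP Λ i) (regularSet Λ) := fun x hx =>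
  AnalyticAt.fun_comp (f := fun x => x + halfPeriod Λ i.succ)
    (Λ.analyticOnNhd_weierstrassP (x + halfPeriod Λ i.succ)
    (add_halfPeriod_notMem hx i.succ)) (by fun_prop)

/-- If the constant were zero, one factor would vanish identically by connectedness, and after a
translation by the half-period `℘` would be constant. -/
lemma exists_mul_shiftP_eq_const (Λ : PeriodPair) (i : Fin 3) :
    ∃ c : ℂ, c ≠ 0 ∧ ∀ x, x ∉ Λ.lattice → x + halfPeriod Λ i.succ ∉ Λ.lattice →
      (Λ.weierstrassP x - root Λ i) * (shiftP Λ i x - root Λ i) = c := by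
  obtain ⟨c, hc⟩ := exists_mul_shift_eq_const (two_mul_halfPeriod_mem Λ i.succ)
    (halfPeriod_succ_notMem Λ i)
  refine ⟨c, ?_, hc⟩
  rintro rfl
  have h1 : AnalyticOnNhd ℂ (fun x => Λ.weierstrassP x - root Λ i) (regularSet Λ) :=
    (analyticOnNhd_weierstrassP Λ).sub analyticOnNhd_const
  have h2 : AnalyticOnNhd ℂ (fun x => shiftP Λ i x - root Λ i) (regularSet Λ) :=
    (analyticOnNhd_shiftP Λ i).sub analyticOnNhd_const
  obtain ⟨x, hx, hne⟩ := exists_weierstrassP_ne Λ (root Λ i)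
  rcases AnalyticOnNhd.eq_zero_or_eq_zero_of_mul_eq_zero h1 h2
    (fun x hx => hc x (notMem_lattice hx) (add_halfPeriod_notMem hx i.succ))
    (isConnected_regularSet Λ).isPreconnected with H | H
  · exact hne (sub_eq_zero.1 (H x hx))
  · have h3 := H (x + halfPeriod Λ i.succ) (add_halfPeriod_mem_regularSet hx _)
    rw [shiftP, add_assoc, ← two_mul, weierstrassP_add_of_mem Λ _ (two_mul_halfPeriod_mem Λ _)]
      at h3
    exact hne (sub_eq_zero.1 h3)

lemma weierstrassP_ne_root (hx : x ∈ regularSet Λ) (i : Fin 3) :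
    Λ.weierstrassP x - root Λ i ≠ 0 := by
  obtain ⟨c, hc, H⟩ := exists_mul_shiftP_eq_const Λ i
  exact left_ne_zero_of_mul
    (H x (notMem_lattice hx) (add_halfPeriod_notMem hx i.succ) ▸ hc)

/-- At `x = ωⱼ` the first factor of the nonzero constant product is `eⱼ - eᵢ`. -/
lemma root_injective (Λ : PeriodPair) : Function.Injective (root Λ) := by
  intro i j hij
  by_contra hne
  obtain ⟨c, hc, H⟩ := exists_mul_shiftP_eq_const Λ i
  have := H (halfPeriod Λ j.succ) (halfPeriod_succ_notMem Λ j)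
    (halfPeriod_add_notMem (Ne.symm hne))
  exact hc (by rw [← this, ← root, hij]; ring)

/-- The constant is read off at `x = ωⱼ`, where `ωⱼ + ωᵢ = -ωₖ` and `℘` is even. -/
lemma weierstrassP_sub_root_mul (hx : x ∈ regularSet Λ) {i j k : Fin 3} (hij : i ≠ j)
    (hik : i ≠ k) (hjk : j ≠ k) :
    (Λ.weierstrassP x - root Λ i) * (shiftP Λ i x - root Λ i)
      = (root Λ i - root Λ j) * (root Λ i - root Λ k) := by
  obtain ⟨c, hc, H⟩ := exists_mul_shiftP_eq_const Λ i
  rw [H x (notMem_lattice hx) (add_halfPeriod_notMem hx i.succ),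
    ← H (halfPeriod Λ j.succ) (halfPeriod_succ_notMem Λ j) (halfPeriod_add_notMem hij.symm),
    shiftP, show halfPeriod Λ j.succ + halfPeriod Λ i.succ = -halfPeriod Λ k.succ by
      linear_combination halfPeriod_add_add (Λ := Λ) hij hik hjk, Λ.weierstrassP_neg]
  change (root Λ j - root Λ i) * (root Λ k - root Λ i) = _
  ring

lemma root_cubic (Λ : PeriodPair) (i : Fin 3) :
    4 * root Λ i ^ 3 - Λ.g₂ * root Λ i - Λ.g₃ = 0 := by
  rw [root, ← Λ.derivWeierstrassP_sq _ (halfPeriod_succ_notMem Λ i),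
    derivWeierstrassP_halfPeriod (two_mul_halfPeriod_mem Λ _)]
  ring

lemma root_sum (Λ : PeriodPair) : root Λ 0 + root Λ 1 + root Λ 2 = 0 := by
  have h0 := root_cubic Λ 0
  have h1 := root_cubic Λ 1
  have h2 := root_cubic Λ 2
  have n01 : root Λ 0 - root Λ 1 ≠ 0 := sub_ne_zero.2 ((root_injective Λ).ne (by decide))
  have n02 : root Λ 0 - root Λ 2 ≠ 0 := sub_ne_zero.2 ((root_injective Λ).ne (by decide))
  have n12 : root Λ 1 - root Λ 2 ≠ 0 := sub_ne_zero.2 ((root_injective Λ).ne (by decide))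
  apply mul_left_cancel₀ (mul_ne_zero (mul_ne_zero n01 n02) n12)
  -- This alternating combination of the three cubics is the Vandermonde product times `e₁ + e₂ +
  -- e₃`, as the cubic has no quadratic term.
  linear_combination (h0 * (root Λ 1 - root Λ 2) - h1 * (root Λ 0 - root Λ 2)
    + h2 * (root Λ 0 - root Λ 1)) / 4

lemma g₂_eq (Λ : PeriodPair) :
    Λ.g₂ = 4 * (root Λ 0 ^ 2 + root Λ 0 * root Λ 1 + root Λ 1 ^ 2) := by
  have n01 : root Λ 0 - root Λ 1 ≠ 0 := sub_ne_zero.2 ((root_injective Λ).ne (by decide))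
  apply mul_left_cancel₀ n01
  linear_combination root_cubic Λ 1 - root_cubic Λ 0

lemma derivWeierstrassP_sq_eq {x : ℂ} (hx : x ∉ Λ.lattice) :
    Λ.derivWeierstrassP x ^ 2 = 4 * (Λ.weierstrassP x - root Λ 0) *
      (Λ.weierstrassP x - root Λ 1) * (Λ.weierstrassP x - root Λ 2) := by
  have h2 : root Λ 2 = -root Λ 0 - root Λ 1 := by linear_combination root_sum Λ
  have h3 : Λ.g₃ = 4 * root Λ 0 ^ 3 - Λ.g₂ * root Λ 0 := by linear_combination -root_cubic Λ 0
  rw [Λ.derivWeierstrassP_sq x hx, h3, g₂_eq, h2]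
  ring

lemma derivWeierstrassP_ne_zero (hx : x ∈ regularSet Λ) : Λ.derivWeierstrassP x ≠ 0 := by
  intro H
  have := derivWeierstrassP_sq_eq (notMem_lattice hx)
  rw [H] at this
  have h0 := weierstrassP_ne_root hx 0
  have h1 := weierstrassP_ne_root hx 1
  have h2 := weierstrassP_ne_root hx 2
  simp_all

/-- Differentiate `℘'² = 4 ∏ (℘ - eᵢ)` and cancel `2℘'`, which has no zero on the regular set. -/
lemma hasDerivAt_derivWeierstrassP (hx : x ∈ regularSet Λ) :
    HasDerivAt Λ.derivWeierstrassP
      (2 * ((Λ.weierstrassP x - root Λ 0) * (Λ.weierstrassP x - root Λ 1) +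
        (Λ.weierstrassP x - root Λ 0) * (Λ.weierstrassP x - root Λ 2) +
        (Λ.weierstrassP x - root Λ 1) * (Λ.weierstrassP x - root Λ 2))) x := by
  have hd := (analyticOnNhd_derivWeierstrassP Λ x hx).differentiableAt.hasDerivAt
  have hP := hasDerivAt_weierstrassP (notMem_lattice hx)
  have h1 := hd.fun_pow 2
  have h2 := (((hP.sub_const (root Λ 0)).const_mul 4).fun_mul (hP.sub_const (root Λ 1))).fun_mul
    (hP.sub_const (root Λ 2))
  have h3 : (fun y => Λ.derivWeierstrassP y ^ 2) =ᶠ[𝓝 x] fun y =>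
      4 * (Λ.weierstrassP y - root Λ 0) * (Λ.weierstrassP y - root Λ 1) *
        (Λ.weierstrassP y - root Λ 2) := by
    filter_upwards [(isOpen_regularSet Λ).mem_nhds hx] with y hy
    exact derivWeierstrassP_sq_eq (notMem_lattice hy)
  have h4 := h1.unique (h2.congr_of_eventuallyEq h3)
  refine hd.congr_deriv ?_
  apply mul_left_cancel₀ (mul_ne_zero two_ne_zero (derivWeierstrassP_ne_zero hx))
  simp only [Nat.cast_ofNat, Nat.add_one_sub_one, pow_one] at h4
  linear_combination h4

end RegularSet

/-! ### Logarithmic derivatives and the Riccati identity. -/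

section LogDer

variable {Λ : PeriodPair} {x : ℂ}

/-- The logarithmic derivative of `∏ᵢ (℘ - eᵢ)^{βᵢ/2}`. -/
def logDer (Λ : PeriodPair) (β : Fin 3 → ℂ) (x : ℂ) : ℂ :=
  ∑ i, β i / 2 * (Λ.derivWeierstrassP x / (Λ.weierstrassP x - root Λ i))

/-- The derivative of `logDer`. -/
def logDerDeriv (Λ : PeriodPair) (β : Fin 3 → ℂ) (x : ℂ) : ℂ :=
  ∑ i, β i * (Λ.weierstrassP x - shiftP Λ i x)

lemma logDer_add_const (Λ : PeriodPair) (β : Fin 3 → ℂ) (c x : ℂ) :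
    logDer Λ (fun i => β i + c) x = logDer Λ β x + c * logDer Λ (fun _ => 1) x := by
  simp only [logDer, Fin.sum_univ_three]
  ring

lemma logDer_add_of_mem (Λ : PeriodPair) (β : Fin 3 → ℂ) (x : ℂ) {w : ℂ} (hw : w ∈ Λ.lattice) :
    logDer Λ β (x + w) = logDer Λ β x := by
  simp only [logDer, weierstrassP_add_of_mem Λ _ hw, derivWeierstrassP_add_of_mem Λ _ hw]

lemma analyticOnNhd_logDer (Λ : PeriodPair) (β : Fin 3 → ℂ) :
    AnalyticOnNhd ℂ (logDer Λ β) (regularSet Λ) := by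
  intro x hx
  have h1 := analyticOnNhd_weierstrassP Λ x hx
  have h2 := analyticOnNhd_derivWeierstrassP Λ x hx
  have h3 := weierstrassP_ne_root hx
  unfold logDer
  refine Finset.analyticAt_fun_sum _ fun i _ => ?_
  exact analyticAt_const.mul (h2.fun_div (h1.sub analyticAt_const) (h3 i))

lemma meromorphic_logDer (Λ : PeriodPair) (β : Fin 3 → ℂ) : Meromorphic (logDer Λ β) := by
  intro x
  have h1 := Λ.meromorphic_weierstrassP x
  have h2 := Λ.meromorphic_derivWeierstrassP x
  unfold logDer
  exact MeromorphicAt.fun_sum fun i _ => by fun_prop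

lemma analyticOnNhd_logDerDeriv (Λ : PeriodPair) (β : Fin 3 → ℂ) :
    AnalyticOnNhd ℂ (logDerDeriv Λ β) (regularSet Λ) := by
  intro x hx
  refine Finset.analyticAt_fun_sum _ fun i _ => ?_
  exact analyticAt_const.mul
    ((analyticOnNhd_weierstrassP Λ x hx).sub (analyticOnNhd_shiftP Λ i x hx))

/-- Puts an arbitrary index in first position, so that computations symmetric in the other two roots
are done once. -/
lemma exists_complementary_roots (hx : x ∈ regularSet Λ) (i : Fin 3) :
    ∃ j k, i ≠ j ∧ i ≠ k ∧ j ≠ k ∧ root Λ i + root Λ j + root Λ k = 0 ∧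
      Λ.derivWeierstrassP x ^ 2 = 4 * (Λ.weierstrassP x - root Λ i) *
        (Λ.weierstrassP x - root Λ j) * (Λ.weierstrassP x - root Λ k) ∧
      HasDerivAt Λ.derivWeierstrassP
        (2 * ((Λ.weierstrassP x - root Λ i) * (Λ.weierstrassP x - root Λ j) +
          (Λ.weierstrassP x - root Λ i) * (Λ.weierstrassP x - root Λ k) +
          (Λ.weierstrassP x - root Λ j) * (Λ.weierstrassP x - root Λ k))) x := by
  have hd := hasDerivAt_derivWeierstrassP hx
  have hs := derivWeierstrassP_sq_eq (notMem_lattice hx)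
  have hsum := root_sum Λ
  match i with
  | 0 => exact ⟨1, 2, by decide, by decide, by decide, hsum, hs, hd⟩
  | 1 => exact ⟨0, 2, by decide, by decide, by decide, by linear_combination hsum,
      by linear_combination hs, hd.congr_deriv (by ring)⟩
  | 2 => exact ⟨0, 1, by decide, by decide, by decide, by linear_combination hsum,
      by linear_combination hs, hd.congr_deriv (by ring)⟩

/-- By the half-period formula, `℘'/(℘ - eᵢ)` has derivative `2(℘(x) - ℘(x + ωᵢ))`. -/
lemma hasDerivAt_logDer (β : Fin 3 → ℂ) (hx : x ∈ regularSet Λ) :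
    HasDerivAt (logDer Λ β) (logDerDeriv Λ β x) x := by
  unfold logDer
  refine HasDerivAt.fun_sum fun i _ => ?_
  have hne := weierstrassP_ne_root hx i
  obtain ⟨j, k, hij, hik, hjk, hsum, hs, hd⟩ := exists_complementary_roots hx i
  have hq := weierstrassP_sub_root_mul hx hij hik hjk
  refine ((hd.fun_div ((hasDerivAt_weierstrassP (notMem_lattice hx)).sub_const
    (root Λ i)) hne).const_mul (β i / 2)).congr_deriv ?_
  rw [← mul_div_assoc, div_eq_iff (pow_ne_zero 2 hne), ← sq (Λ.derivWeierstrassP x), hs]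
  have h4 : root Λ k = -root Λ i - root Λ j := by linear_combination hsum
  rw [h4] at hq ⊢
  linear_combination β i * (Λ.weierstrassP x - root Λ i) * hq

/-- Up to a constant, `℘'` is the gauge function with all exponents `1`; multiplying by it shifts
every exponent by one. -/
lemma hasDerivAt_derivWeierstrassP' (hx : x ∈ regularSet Λ) :
    HasDerivAt Λ.derivWeierstrassP (logDer Λ (fun _ => 1) x * Λ.derivWeierstrassP x) x := by
  refine (hasDerivAt_derivWeierstrassP hx).congr_deriv ?_
  have h0 := weierstrassP_ne_root hx 0
  have h1 := weierstrassP_ne_root hx 1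
  have h2 := weierstrassP_ne_root hx 2
  have hs := derivWeierstrassP_sq_eq (notMem_lattice hx)
  have : logDer Λ (fun _ => 1) x * Λ.derivWeierstrassP x = Λ.derivWeierstrassP x ^ 2 * (1 / 2) *
      (1 / (Λ.weierstrassP x - root Λ 0) + 1 / (Λ.weierstrassP x - root Λ 1) +
        1 / (Λ.weierstrassP x - root Λ 2)) := by
    simp only [logDer, Fin.sum_univ_three]; ring
  rw [this, hs]
  field_simp
  ring

/-- The product of the logarithmic derivative with `℘'` is a polynomial in `℘`. -/
lemma logDer_mul_derivWeierstrassP (β : Fin 3 → ℂ) (hx : x ∈ regularSet Λ) :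
    logDer Λ β x * Λ.derivWeierstrassP x =
      2 * (β 0 * (Λ.weierstrassP x - root Λ 1) * (Λ.weierstrassP x - root Λ 2) +
        β 1 * (Λ.weierstrassP x - root Λ 0) * (Λ.weierstrassP x - root Λ 2) +
        β 2 * (Λ.weierstrassP x - root Λ 0) * (Λ.weierstrassP x - root Λ 1)) := by
  have h0 := weierstrassP_ne_root hx 0
  have h1 := weierstrassP_ne_root hx 1
  have h2 := weierstrassP_ne_root hx 2
  have hs := derivWeierstrassP_sq_eq (notMem_lattice hx)
  have : logDer Λ β x * Λ.derivWeierstrassP x = Λ.derivWeierstrassP x ^ 2 * (1 / 2) *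
      (β 0 / (Λ.weierstrassP x - root Λ 0) + β 1 / (Λ.weierstrassP x - root Λ 1) +
        β 2 / (Λ.weierstrassP x - root Λ 2)) := by
    simp only [logDer, Fin.sum_univ_three]; ring
  rw [this, hs]
  field_simp
  ring

/-- The constant term in `sum_shiftP_eq_riccati`. -/
def riccatiConst (Λ : PeriodPair) (β : Fin 3 → ℂ) : ℂ :=
  2 * (β 0 * β 1 * root Λ 2 + β 0 * β 2 * root Λ 1 + β 1 * β 2 * root Λ 0) -
    ∑ i, β i ^ 2 * root Λ i

/-- Expresses that `Φ` solves a Schrödinger equation. In `χ²` the squares come from `(℘'/(℘ - eᵢ))²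
= 4(℘ + ℘(x + ωᵢ) + eᵢ)` and the mixed products equal `4(℘ - eₖ)`. -/
lemma sum_shiftP_eq_riccati (β : Fin 3 → ℂ) (hx : x ∈ regularSet Λ) :
    ∑ i, β i * (β i - 1) * shiftP Λ i x = logDerDeriv Λ β x + logDer Λ β x ^ 2 -
      ((∑ i, β i) ^ 2 + ∑ i, β i) * Λ.weierstrassP x + riccatiConst Λ β := by
  have h0 := weierstrassP_ne_root hx 0
  have h1 := weierstrassP_ne_root hx 1
  have h2 := weierstrassP_ne_root hx 2
  have hs := derivWeierstrassP_sq_eq (notMem_lattice hx)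
  have hsum := root_sum Λ
  have key : ∀ a b c z p q : ℂ, z - a ≠ 0 → (z - a) * (q - a) = (a - b) * (a - c) →
      p ^ 2 = 4 * (z - a) * (z - b) * (z - c) → a + b + c = 0 →
      (p / (z - a)) ^ 2 = 4 * (z + q + a) := by
    intro a b c z p q h1 h2 h3 h4
    rw [div_pow, div_eq_iff (pow_ne_zero 2 h1), h3]
    obtain rfl : c = -a - b := by linear_combination h4
    linear_combination -4 * (z - a) * h2
  have key' : ∀ a b c z p : ℂ, z - a ≠ 0 → z - b ≠ 0 →
      p ^ 2 = 4 * (z - a) * (z - b) * (z - c) →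
      (p / (z - a)) * (p / (z - b)) = 4 * (z - c) := by
    intro a b c z p h1 h2 h3
    rw [div_mul_div_comm, ← sq, h3]
    field_simp
  have r0 := key _ _ _ _ (Λ.derivWeierstrassP x) _ h0 (weierstrassP_sub_root_mul hx
      (i := 0) (j := 1) (k := 2) (by decide) (by decide) (by decide)) hs hsum
  have r1 := key _ _ _ _ (Λ.derivWeierstrassP x) _ h1 (weierstrassP_sub_root_mul hx
      (i := 1) (j := 0) (k := 2) (by decide) (by decide) (by decide))
      (by linear_combination hs) (by linear_combination hsum)
  have r2 := key _ _ _ _ (Λ.derivWeierstrassP x) _ h2 (weierstrassP_sub_root_mul hx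
      (i := 2) (j := 0) (k := 1) (by decide) (by decide) (by decide))
      (by linear_combination hs) (by linear_combination hsum)
  have r01 := key' _ _ (root Λ 2) _ (Λ.derivWeierstrassP x) h0 h1 (by linear_combination hs)
  have r02 := key' _ _ (root Λ 1) _ (Λ.derivWeierstrassP x) h0 h2 (by linear_combination hs)
  have r12 := key' _ _ (root Λ 0) _ (Λ.derivWeierstrassP x) h1 h2 (by linear_combination hs)
  simp only [logDer, logDerDeriv, riccatiConst, Fin.sum_univ_three]
  linear_combination -(β 0 ^ 2 / 4) * r0 - (β 1 ^ 2 / 4) * r1 - (β 2 ^ 2 / 4) * r2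
    - (β 0 * β 1 / 2) * r01 - (β 0 * β 2 / 2) * r02 - (β 1 * β 2 / 2) * r12

end LogDer

/-! ### Branches of the gauge function. -/

section Gauge

variable {Λ : PeriodPair} {β : Fin 3 → ℂ} {U : Set ℂ} {Φ : ℂ → ℂ}

/-- `Φ` is a nowhere vanishing function on `U` with logarithmic derivative `logDer Λ β`. -/
def IsGauge (Λ : PeriodPair) (β : Fin 3 → ℂ) (U : Set ℂ) (Φ : ℂ → ℂ) : Prop :=
  ∀ x ∈ U, Φ x ≠ 0 ∧ HasDerivAt Φ (logDer Λ β x * Φ x) x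

lemma IsGauge.analyticOnNhd (h : IsGauge Λ β U Φ) (hU : IsOpen U) : AnalyticOnNhd ℂ Φ U :=
  DifferentiableOn.analyticOnNhd
    (fun x hx => (h x hx).2.differentiableAt.differentiableWithinAt) hU

/-- Replaces chosen logarithms by the first order equation they imply, which is all that the algebra
below needs. -/
lemma IsBranch.isGauge {α : Fin 4 → ℂ} (h : IsBranch Λ α U Φ) (hU : IsOpen U)
    (hUD : U ⊆ regularSet Λ) : IsGauge Λ (fun i => α i.succ) U Φ := by
  obtain ⟨g, hg, hexp, hΦ⟩ := h
  have hgd : ∀ i, ∀ x ∈ U, HasDerivAt (g i)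
      (Λ.derivWeierstrassP x / (Λ.weierstrassP x - root Λ i)) x := by
    intro i x hx
    have h1 := (hg i x hx).differentiableAt.hasDerivAt
    have h2 : (fun y => Complex.exp (g i y)) =ᶠ[𝓝 x] fun y => Λ.weierstrassP y - root Λ i := by
      filter_upwards [hU.mem_nhds hx] with y hy using hexp i y hy
    have h3 := h1.cexp.unique (((hasDerivAt_weierstrassP
      (notMem_lattice (hUD hx))).sub_const (root Λ i)).congr_of_eventuallyEq h2)
    refine h1.congr_deriv ?_
    rw [eq_div_iff (weierstrassP_ne_root (hUD hx) i), ← h3, hexp i x hx]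
    exact mul_comm _ _
  intro x hx
  refine ⟨?_, ?_⟩
  · rw [hΦ x hx]
    exact Finset.prod_ne_zero_iff.2 fun i _ => Complex.exp_ne_zero _
  · have h1 : HasDerivAt (fun y => Complex.exp (∑ i : Fin 3, α i.succ / 2 * g i y))
        (Complex.exp (∑ i : Fin 3, α i.succ / 2 * g i x) *
          logDer Λ (fun i => α i.succ) x) x :=
      (HasDerivAt.fun_sum fun i _ => (hgd i x hx).const_mul (α i.succ / 2)).cexp
    have h2 : Φ =ᶠ[𝓝 x] fun y => Complex.exp (∑ i : Fin 3, α i.succ / 2 * g i y) := by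
      filter_upwards [hU.mem_nhds hx] with y hy
      rw [hΦ y hy, Complex.exp_sum]
    refine (h1.congr_of_eventuallyEq h2).congr_deriv ?_
    rw [h2.eq_of_nhds, mul_comm]

lemma exists_isBranch (α : Fin 4 → ℂ) {s : Set ℂ} {x₀ : ℂ} (hx₀ : x₀ ∈ regularSet Λ)
    (hs : s ∈ 𝓝 x₀) :
    ∃ r > 0, ∃ Φ, Metric.ball x₀ r ⊆ regularSet Λ ∧ Metric.ball x₀ r ⊆ s ∧
      IsBranch Λ α (Metric.ball x₀ r) Φ := by
  have hne := weierstrassP_ne_root hx₀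
  -- The normalised quotient is `1` at `x₀`, so the principal logarithm is holomorphic on it nearby,
  -- whatever the argument of `℘(x₀) - eᵢ`.
  have h1 : ∀ i : Fin 3, ∀ᶠ x in 𝓝 x₀,
      (Λ.weierstrassP x - root Λ i) / (Λ.weierstrassP x₀ - root Λ i) ∈ Complex.slitPlane := by
    intro i
    have hc : ContinuousAt (fun x => (Λ.weierstrassP x - root Λ i) /
        (Λ.weierstrassP x₀ - root Λ i)) x₀ :=
      ((analyticOnNhd_weierstrassP Λ x₀ hx₀).continuousAt.sub continuousAt_const).div_const _
    refine hc.eventually (Complex.isOpen_slitPlane.mem_nhds ?_)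
    simp [div_self (hne i)]
  obtain ⟨r, hr, hball⟩ := Metric.eventually_nhds_iff_ball.1
    ((eventually_all.2 h1).and ((eventually_mem_set.2 ((isOpen_regularSet Λ).mem_nhds hx₀)).and
      (eventually_mem_set.2 hs)))
  refine ⟨r, hr, _, fun x hx => (hball x hx).2.1, fun x hx => (hball x hx).2.2,
    fun i x => Complex.log ((Λ.weierstrassP x - root Λ i) / (Λ.weierstrassP x₀ - root Λ i)) +
      Complex.log (Λ.weierstrassP x₀ - root Λ i), fun i x hx => ?_, fun i x hx => ?_,
    fun x _ => rfl⟩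
  · refine AnalyticAt.add (AnalyticAt.clog ?_ ((hball x hx).1 i)) analyticAt_const
    exact ((analyticOnNhd_weierstrassP Λ x (hball x hx).2.1).sub analyticAt_const).div_const
  · rw [Complex.exp_add, Complex.exp_log (Complex.slitPlane_ne_zero ((hball x hx).1 i)),
      Complex.exp_log (hne i), div_mul_cancel₀ _ (hne i)]
    rfl

end Gauge

/-! ### The Darboux chain, its kernel and its commutation with `H`. -/

section Ladder

variable {Λ : PeriodPair} {β : Fin 3 → ℂ} {U : Set ℂ} {f g : ℂ → ℂ} {x : ℂ}

/-- The operator `d/dx - (log ∏ᵢ (℘ - eᵢ)^{βᵢ/2})'`. -/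
def lower (Λ : PeriodPair) (β : Fin 3 → ℂ) (f : ℂ → ℂ) (x : ℂ) : ℂ :=
  deriv f x - logDer Λ β x * f x

/-- The product `(d/dx - χₙ₋₁) ⋯ (d/dx - χ₀)`, where `χₖ` is `logDer` of the exponents `β + k`. -/
def ladder (Λ : PeriodPair) (β : Fin 3 → ℂ) : ℕ → (ℂ → ℂ) → ℂ → ℂ
  | 0, f => f
  | n + 1, f => lower Λ (fun i => β i + n) (ladder Λ β n f)

lemma lower_analyticOnNhd (hf : AnalyticOnNhd ℂ f U) (hUD : U ⊆ regularSet Λ) :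
    AnalyticOnNhd ℂ (lower Λ β f) U :=
  hf.deriv.sub (((analyticOnNhd_logDer Λ β).mono hUD).mul hf)

lemma lower_congr (hU : IsOpen U) (h : Set.EqOn f g U) :
    Set.EqOn (lower Λ β f) (lower Λ β g) U := fun x hx => by
  simp only [lower, h.deriv hU hx, h hx]

lemma lower_add (hf : DifferentiableAt ℂ f x) (hg : DifferentiableAt ℂ g x) :
    lower Λ β (fun y => f y + g y) x = lower Λ β f x + lower Λ β g x := by
  simp only [lower, deriv_fun_add hf hg]
  ring

lemma lower_const_mul (c : ℂ) : lower Λ β (fun y => c * f y) x = c * lower Λ β f x := by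
  simp only [lower, deriv_const_mul_field]
  ring

lemma ladder_analyticOnNhd (hf : AnalyticOnNhd ℂ f U) (hUD : U ⊆ regularSet Λ) (n : ℕ) :
    AnalyticOnNhd ℂ (ladder Λ β n f) U := by
  induction n with
  | zero => exact hf
  | succ n ih => exact lower_analyticOnNhd ih hUD

lemma ladder_add (hU : IsOpen U) (hUD : U ⊆ regularSet Λ) (hf : AnalyticOnNhd ℂ f U)
    (hg : AnalyticOnNhd ℂ g U) (n : ℕ) :
    Set.EqOn (ladder Λ β n fun y => f y + g y)
      (fun y => ladder Λ β n f y + ladder Λ β n g y) U := by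
  induction n with
  | zero => exact fun _ _ => rfl
  | succ n ih =>
    intro x hx
    rw [ladder, lower_congr hU ih hx,
      lower_add (ladder_analyticOnNhd hf hUD n x hx).differentiableAt
        (ladder_analyticOnNhd hg hUD n x hx).differentiableAt]
    rfl

lemma ladder_const_mul (c : ℂ) (n : ℕ) :
    ladder Λ β n (fun y => c * f y) = fun y => c * ladder Λ β n f y := by
  induction n with
  | zero => rfl
  | succ n ih =>
    ext x
    rw [ladder, ih, lower_const_mul]
    rfl

/-- `(d/dx - χ)` in terms of the gauge function. -/
lemma lower_gauge_mul {Φ u : ℂ → ℂ} {u' : ℂ} (hΦ : HasDerivAt Φ (logDer Λ β x * Φ x) x)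
    (hu : HasDerivAt u u' x) : lower Λ β (fun y => Φ y * u y) x = Φ x * u' := by
  rw [lower, (hΦ.fun_mul hu).deriv]
  ring

lemma IsGauge.mul_pow {Φ : ℂ → ℂ} (h : IsGauge Λ β U Φ) (hUD : U ⊆ regularSet Λ) (n : ℕ) :
    IsGauge Λ (fun i => β i + n) U (fun y => Φ y * Λ.derivWeierstrassP y ^ n) := by
  intro x hx
  have hne := derivWeierstrassP_ne_zero (hUD hx)
  refine ⟨mul_ne_zero (h x hx).1 (pow_ne_zero _ hne), ?_⟩
  refine ((h x hx).2.fun_mul ((hasDerivAt_derivWeierstrassP' (hUD hx)).fun_pow n)).congr_deriv ?_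
  rw [logDer_add_const]
  rcases n with - | n
  · simp
  · push_cast
    ring

lemma hasDerivAt_eval_weierstrassP (p : Polynomial ℂ) (hx : x ∈ regularSet Λ) :
    HasDerivAt (fun y => p.eval (Λ.weierstrassP y))
      (Λ.derivWeierstrassP x * p.derivative.eval (Λ.weierstrassP x)) x :=
  ((p.hasDerivAt _).comp x (hasDerivAt_weierstrassP (notMem_lattice hx))).congr_deriv
    (mul_comm _ _)

/-- Each factor removes the derivative of its own gauge function `Φ ℘'ⁿ`, leaving `d/dx` on a
polynomial in `℘`, which produces one more `℘'`. -/
lemma ladder_gauge_eval {Φ : ℂ → ℂ} (h : IsGauge Λ β U Φ) (hU : IsOpen U)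
    (hUD : U ⊆ regularSet Λ) (p : Polynomial ℂ) (n : ℕ) :
    Set.EqOn (ladder Λ β n fun y => Φ y * p.eval (Λ.weierstrassP y))
      (fun y => Φ y * Λ.derivWeierstrassP y ^ n *
        (Polynomial.derivative^[n] p).eval (Λ.weierstrassP y)) U := by
  induction n with
  | zero => intro x _; simp [ladder]
  | succ n ih =>
    intro x hx
    rw [ladder, lower_congr hU ih hx, lower_gauge_mul (h.mul_pow hUD n x hx).2
      (hasDerivAt_eval_weierstrassP _ (hUD hx)), Function.iterate_succ_apply']
    ring

/-- The kernel of `ladder` consists of the gauge function times polynomials in `℘`. -/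
lemma exists_eq_gauge_eval_of_ladder_eq_zero {Φ : ℂ → ℂ} (h : IsGauge Λ β U Φ) (hU : IsOpen U)
    (hc : IsPreconnected U) (hUD : U ⊆ regularSet Λ) (n : ℕ) :
    ∀ f, AnalyticOnNhd ℂ f U → (∀ x ∈ U, ladder Λ β n f x = 0) →
      ∃ p ∈ Polynomial.degreeLT ℂ n, Set.EqOn f (fun y => Φ y * p.eval (Λ.weierstrassP y)) U := by
  have hev : ∀ p : Polynomial ℂ,
      AnalyticOnNhd ℂ (fun y => Φ y * p.eval (Λ.weierstrassP y)) U := fun p =>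
    DifferentiableOn.analyticOnNhd (fun x hx => ((h x hx).2.differentiableAt.fun_mul
      (hasDerivAt_eval_weierstrassP p (hUD hx)).differentiableAt).differentiableWithinAt) hU
  induction n with
  | zero =>
    intro f _ h0
    exact ⟨0, zero_mem _, fun x hx => by simpa [ladder] using h0 x hx⟩
  | succ n ih =>
    intro f hf h0
    set Ψ : ℂ → ℂ := fun y => Φ y * Λ.derivWeierstrassP y ^ n with hΨ
    have hΨg : IsGauge Λ (fun i => β i + n) U Ψ := h.mul_pow hUD n
    -- The last factor annihilates the result of the first `n`, which is therefore a constant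
    -- multiple of its gauge function `Ψ`.
    have hquot : ∀ x ∈ U, HasDerivAt (fun y => ladder Λ β n f y / Ψ y) 0 x := by
      intro x hx
      have h1 := (ladder_analyticOnNhd (β := β) hf hUD n x hx).differentiableAt.hasDerivAt
      refine (h1.fun_div (hΨg x hx).2 (hΨg x hx).1).congr_deriv ?_
      have h2 := h0 x hx
      rw [ladder, lower] at h2
      rw [div_eq_zero_iff]
      left
      linear_combination Ψ x * h2
    obtain ⟨c, hcst⟩ := hU.exists_is_const_of_deriv_eq_zero hc
      (fun x hx => (hquot x hx).differentiableAt.differentiableWithinAt)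
      (fun x hx => (hquot x hx).deriv)
    have hL : ∀ x ∈ U, ladder Λ β n f x = c * Ψ x := by
      intro x hx
      rw [← hcst x hx, div_mul_cancel₀ _ (hΨg x hx).1]
    -- Chosen with `n`-th derivative `c`: subtracting `Φ m(℘)` from `f` leaves an element of the
    -- kernel of the first `n` factors.
    set m : Polynomial ℂ := Polynomial.monomial n (c / (n.factorial : ℂ)) with hm
    have hfac : (n.factorial : ℂ) ≠ 0 := by exact_mod_cast n.factorial_ne_zero
    have hmd : Polynomial.derivative^[n] m = Polynomial.C c := by
      rw [hm, ← Polynomial.C_mul_X_pow_eq_monomial, Polynomial.iterate_derivative_C_mul,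
        Polynomial.iterate_derivative_X_pow_eq_C_mul, Nat.descFactorial_self]
      rw [Nat.sub_self, pow_zero, mul_one, ← Polynomial.C_mul,
        div_mul_cancel₀ _ hfac]
    obtain ⟨p, hp, hpf⟩ := ih (fun y => f y + (-1) * (Φ y * m.eval (Λ.weierstrassP y)))
      (hf.add (analyticOnNhd_const.mul (hev m))) (by
        intro x hx
        rw [ladder_add hU hUD hf (analyticOnNhd_const.mul (hev m)) n hx, ladder_const_mul]
        simp only []
        rw [ladder_gauge_eval h hU hUD m n hx, hmd, hL x hx]
        simp [hΨ]
        ring)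
    refine ⟨p + m, add_mem (Polynomial.degreeLT_mono n.le_succ hp) ?_, fun x hx => ?_⟩
    · rw [Polynomial.mem_degreeLT]
      exact (Polynomial.degree_monomial_le _ _).trans_lt (by exact_mod_cast n.lt_succ_self)
    · have := hpf hx
      simp only [Polynomial.eval_add] at this ⊢
      linear_combination this

/-- The Schrödinger operator with potential `∑ᵢ βᵢ(βᵢ - 1) ℘(x + ωᵢ) + m ℘(x)`. -/
def ladderHam (Λ : PeriodPair) (β : Fin 3 → ℂ) (m : ℂ) (f : ℂ → ℂ) (x : ℂ) : ℂ :=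
  -iteratedDeriv 2 f x +
    (∑ i, β i * (β i - 1) * shiftP Λ i x + m * Λ.weierstrassP x) * f x

lemma iteratedDeriv_two' (f : ℂ → ℂ) : iteratedDeriv 2 f = deriv (deriv f) := by
  rw [iteratedDeriv_succ, iteratedDeriv_one]

lemma ladderHam_analyticOnNhd (hf : AnalyticOnNhd ℂ f U) (hUD : U ⊆ regularSet Λ) (m : ℂ) :
    AnalyticOnNhd ℂ (ladderHam Λ β m f) U := by
  intro x hx
  have h1 : AnalyticAt ℂ (iteratedDeriv 2 f) x := by
    rw [iteratedDeriv_two']; exact (hf x hx).deriv.deriv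
  refine h1.neg.add (AnalyticAt.mul (AnalyticAt.add ?_ ?_) (hf x hx))
  · exact Finset.analyticAt_fun_sum _ fun i _ =>
      analyticAt_const.mul (analyticOnNhd_shiftP Λ i x (hUD hx))
  · exact analyticAt_const.mul (analyticOnNhd_weierstrassP Λ x (hUD hx))

lemma ladderHam_congr (hU : IsOpen U) (h : Set.EqOn f g U) (m : ℂ) :
    Set.EqOn (ladderHam Λ β m f) (ladderHam Λ β m g) U := fun x hx => by
  simp only [ladderHam, h.iteratedDeriv_of_isOpen hU 2 hx, h hx]

/-- One Darboux step. -/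
lemma lower_ladderHam (hU : IsOpen U) (hUD : U ⊆ regularSet Λ) (hg : AnalyticOnNhd ℂ g U)
    (m : ℂ) (hx : x ∈ U) :
    lower Λ β (ladderHam Λ β m g) x =
      ladderHam Λ (fun i => β i + 1) (m - 2 * ∑ i, β i) (lower Λ β g) x +
        (m - (∑ i, β i) ^ 2 - ∑ i, β i) * (Λ.derivWeierstrassP x * g x) := by
  set s := ∑ i, β i with hs
  have hxD := hUD hx
  have d0 := (hg x hx).differentiableAt.hasDerivAt
  have d1 : ∀ y ∈ U, HasDerivAt (deriv g) (deriv (deriv g) y) y :=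
    fun y hy => (hg y hy).deriv.differentiableAt.hasDerivAt
  have d2 := (hg x hx).deriv.deriv.differentiableAt.hasDerivAt
  have c0 : ∀ y ∈ U, HasDerivAt (logDer Λ β) (logDerDeriv Λ β y) y :=
    fun y hy => hasDerivAt_logDer β (hUD hy)
  have c1 := (analyticOnNhd_logDerDeriv Λ β x hxD).differentiableAt.hasDerivAt
  have dP := hasDerivAt_weierstrassP (notMem_lattice hxD)
  -- The part `χ' + χ²` of the potential is the one factored as `-(d/dx + χ)(d/dx - χ)`; the
  -- remaining multiple of `℘` creates the `℘'` term.
  have hV : ∀ y ∈ U, ∑ i, β i * (β i - 1) * shiftP Λ i y + m * Λ.weierstrassP y =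
      logDerDeriv Λ β y + logDer Λ β y ^ 2 + (m - s ^ 2 - s) * Λ.weierstrassP y +
        riccatiConst Λ β := by
    intro y hy
    rw [sum_shiftP_eq_riccati β (hUD hy)]
    ring
  have e1 : Set.EqOn (ladderHam Λ β m g) (fun y => -deriv (deriv g) y +
      (logDerDeriv Λ β y + logDer Λ β y ^ 2 + (m - s ^ 2 - s) * Λ.weierstrassP y +
        riccatiConst Λ β) * g y) U := by
    intro y hy
    simp only [ladderHam, hV y hy, iteratedDeriv_two']
  have hD1 := d2.fun_neg.fun_add (((((c1.fun_add ((c0 x hx).fun_pow 2)).fun_add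
    (dP.const_mul (m - s ^ 2 - s))).add_const (riccatiConst Λ β))).fun_mul d0)
  have e2 : Set.EqOn (deriv (lower Λ β g)) (fun y => deriv (deriv g) y -
      (logDerDeriv Λ β y * g y + logDer Λ β y * deriv g y)) U := by
    intro y hy
    exact ((d1 y hy).fun_sub ((c0 y hy).fun_mul
      (hg y hy).differentiableAt.hasDerivAt)).deriv
  have hD2 := d2.fun_sub ((c1.fun_mul d0).fun_add ((c0 x hx).fun_mul (d1 x hx)))
  -- Exchanging the factors changes the potential by `-2χ'`, which raises each exponent by one and
  -- lowers `m` by `2s`.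
  have e3 : ∑ i, (β i + 1) * (β i + 1 - 1) * shiftP Λ i x + (m - 2 * s) * Λ.weierstrassP x =
      (∑ i, β i * (β i - 1) * shiftP Λ i x + m * Λ.weierstrassP x) -
        2 * logDerDeriv Λ β x := by
    simp only [hs, logDerDeriv, Fin.sum_univ_three]
    ring
  rw [lower, (e1.deriv hU) hx, hD1.deriv, e1 hx, ladderHam, iteratedDeriv_two',
    (e2.deriv hU) hx, hD2.deriv, e3, hV x hx, lower]
  simp only [Nat.cast_ofNat, Nat.add_one_sub_one, pow_one]
  ring

/-- The intermediate coefficients of `℘` in the Darboux chain. -/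
def chainCoeff (β : Fin 3 → ℂ) (m : ℂ) (n : ℕ) : ℂ :=
  m - 2 * n * (∑ i, β i) - 3 * n * (n - 1)

/-- The coefficient of the defect term in `ladder_ladderHam`. -/
def defect (β : Fin 3 → ℂ) (m : ℂ) (n : ℕ) : ℂ :=
  n * (m - (∑ i, β i) ^ 2 - ∑ i, β i) - 4 * n * (n - 1) * (∑ i, β i) -
    2 * n * (n - 1) * (2 * n - 1)

/-- Moves the error term through the next factor: `℘'` absorbs the extra unit in the exponents. -/
lemma lower_derivWeierstrassP_mul_ladder (hUD : U ⊆ regularSet Λ)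
    (hf : AnalyticOnNhd ℂ f U) (n : ℕ) (hx : x ∈ U) :
    lower Λ (fun i => β i + (n + 1 : ℕ))
      (fun y => Λ.derivWeierstrassP y * ladder Λ β n f y) x =
      Λ.derivWeierstrassP x * ladder Λ β (n + 1) f x := by
  have h1 := (ladder_analyticOnNhd (β := β) hf hUD n x hx).differentiableAt.hasDerivAt
  rw [lower, ((hasDerivAt_derivWeierstrassP' (hUD hx)).fun_mul h1).deriv, ladder, lower,
    logDer_add_const, logDer_add_const]
  push_cast
  ring

/-- At each step the old error and the newly created one are both multiples of `℘'` times the same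
partial product, so one scalar records them. At `n = 0` the truncated index `n - 1` is harmless,
since the scalar is zero. -/
lemma ladder_ladderHam (hU : IsOpen U) (hUD : U ⊆ regularSet Λ) (hf : AnalyticOnNhd ℂ f U)
    (m : ℂ) (n : ℕ) :
    Set.EqOn (ladder Λ β n (ladderHam Λ β m f))
      (fun y => ladderHam Λ (fun i => β i + n) (chainCoeff β m n) (ladder Λ β n f) y +
        defect β m n * (Λ.derivWeierstrassP y * ladder Λ β (n - 1) f y)) U := by
  induction n with
  | zero => intro x _; simp [ladder, chainCoeff, defect]
  | succ n ih =>
    intro x hx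
    have hLn := ladder_analyticOnNhd (β := β) hf hUD n
    have hLn' := ladder_analyticOnNhd (β := β) hf hUD (n - 1)
    have a1 := ladderHam_analyticOnNhd (β := fun i => β i + n) hLn hUD (chainCoeff β m n)
    have a2 : AnalyticOnNhd ℂ (fun y => Λ.derivWeierstrassP y * ladder Λ β (n - 1) f y) U :=
      ((analyticOnNhd_derivWeierstrassP Λ).mono hUD).mul hLn'
    have step2 : lower Λ (fun i => β i + n) (fun y => defect β m n *
        (Λ.derivWeierstrassP y * ladder Λ β (n - 1) f y)) x =
          defect β m n * (Λ.derivWeierstrassP x * ladder Λ β n f x) := by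
      rw [lower_const_mul]
      rcases n with - | n
      · simp [defect]
      · rw [Nat.add_sub_cancel, lower_derivWeierstrassP_mul_ladder hUD hf n hx]
    have hsum : ∑ i, (β i + n) = ∑ i, β i + 3 * n := by
      simp only [Fin.sum_univ_three]; ring
    rw [ladder, lower_congr hU ih hx, lower_add (a1 x hx).differentiableAt
      ((a2 x hx).differentiableAt.const_mul _), lower_ladderHam hU hUD hLn _ hx, step2,
      hsum, Nat.add_sub_cancel]
    have e1 : chainCoeff β m n - 2 * (∑ i, β i + 3 * n) = chainCoeff β m (n + 1) := by
      simp only [chainCoeff]; push_cast; ring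
    have e2 : (fun i => β i + (n : ℂ) + 1) = fun i => β i + ((n + 1 : ℕ) : ℂ) := by
      ext i; push_cast; ring
    have e3 : chainCoeff β m n - (∑ i, β i + 3 * n) ^ 2 - (∑ i, β i + 3 * n) + defect β m n
        = defect β m (n + 1) := by
      simp only [chainCoeff, defect]; push_cast; ring
    rw [e1, e2, ← e3]
    simp only [ladder]
    ring

end Ladder

/-! ### The chain as a monic operator with periodic meromorphic coefficients. -/

section Coefficients

variable {Λ : PeriodPair} {β : Fin 3 → ℂ} {U : Set ℂ} {f : ℂ → ℂ} {x : ℂ}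

/-- The coefficient of `(d/dx)ᵏ` in `ladder Λ β n`. -/
def ladderCoeff (Λ : PeriodPair) (β : Fin 3 → ℂ) : ℕ → ℕ → ℂ → ℂ
  | 0, k => fun _ => if k = 0 then 1 else 0
  | n + 1, 0 => fun x => deriv (ladderCoeff Λ β n 0) x -
      logDer Λ (fun i => β i + n) x * ladderCoeff Λ β n 0 x
  | n + 1, k + 1 => fun x => ladderCoeff Λ β n k x + (deriv (ladderCoeff Λ β n (k + 1)) x -
      logDer Λ (fun i => β i + n) x * ladderCoeff Λ β n (k + 1) x)

lemma ladderCoeff_analyticOnNhd (Λ : PeriodPair) (β : Fin 3 → ℂ) (n k : ℕ) :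
    AnalyticOnNhd ℂ (ladderCoeff Λ β n k) (regularSet Λ) := by
  induction n generalizing k with
  | zero => exact analyticOnNhd_const
  | succ n ih =>
    rcases k with - | k
    · exact (ih 0).deriv.sub ((analyticOnNhd_logDer Λ _).mul (ih 0))
    · exact (ih k).add ((ih (k + 1)).deriv.sub ((analyticOnNhd_logDer Λ _).mul (ih (k + 1))))

lemma ladderCoeff_meromorphic (Λ : PeriodPair) (β : Fin 3 → ℂ) (n k : ℕ) :
    Meromorphic (ladderCoeff Λ β n k) := by
  induction n generalizing k with
  | zero => exact Meromorphic.const _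
  | succ n ih =>
    rcases k with - | k
    · exact (ih 0).deriv.sub ((meromorphic_logDer Λ _).mul (ih 0))
    · exact (ih k).add ((ih (k + 1)).deriv.sub ((meromorphic_logDer Λ _).mul (ih (k + 1))))

lemma deriv_add_of_periodic {g : ℂ → ℂ} {w : ℂ} (h : ∀ x, g (x + w) = g x) (x : ℂ) :
    deriv g (x + w) = deriv g x := by
  rw [← deriv_comp_add_const, funext h]

lemma ladderCoeff_add_of_mem {w : ℂ} (hw : w ∈ Λ.lattice) (n k : ℕ) (x : ℂ) :
    ladderCoeff Λ β n k (x + w) = ladderCoeff Λ β n k x := by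
  induction n generalizing k x with
  | zero => rfl
  | succ n ih =>
    rcases k with - | k
    · simp only [ladderCoeff, ih, deriv_add_of_periodic (ih 0), logDer_add_of_mem Λ _ _ hw]
    · simp only [ladderCoeff, ih, deriv_add_of_periodic (ih (k + 1)),
        logDer_add_of_mem Λ _ _ hw]

lemma ladderCoeff_eq_zero {n k : ℕ} (h : n < k) : ladderCoeff Λ β n k = 0 := by
  induction n generalizing k with
  | zero => ext x; simp [ladderCoeff, h.ne']
  | succ n ih =>
    obtain ⟨k, rfl⟩ := Nat.exists_eq_succ_of_ne_zero (Nat.ne_zero_of_lt h)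
    ext x
    simp [ladderCoeff, ih (Nat.lt_of_succ_lt_succ h),
      ih ((Nat.lt_of_succ_lt_succ h).trans k.lt_succ_self)]

lemma ladderCoeff_self (n : ℕ) : ladderCoeff Λ β n n = 1 := by
  induction n with
  | zero => ext x; simp [ladderCoeff]
  | succ n ih => ext x; simp [ladderCoeff, ih, ladderCoeff_eq_zero n.lt_succ_self]

lemma ladder_eq_sum (hU : IsOpen U) (hUD : U ⊆ regularSet Λ) (hf : AnalyticOnNhd ℂ f U) (n : ℕ) :
    Set.EqOn (ladder Λ β n f)
      (fun x => ∑ k ∈ Finset.range (n + 1), ladderCoeff Λ β n k x * iteratedDeriv k f x) U := by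
  induction n with
  | zero => intro x _; simp [ladder, ladderCoeff]
  | succ n ih =>
    intro x hx
    have hd : HasDerivAt
        (fun x => ∑ k ∈ Finset.range (n + 1), ladderCoeff Λ β n k x * iteratedDeriv k f x)
        (∑ k ∈ Finset.range (n + 1), (deriv (ladderCoeff Λ β n k) x * iteratedDeriv k f x +
          ladderCoeff Λ β n k x * iteratedDeriv (k + 1) f x)) x := by
      refine HasDerivAt.fun_sum fun k _ => HasDerivAt.fun_mul ?_ ?_
      · exact (ladderCoeff_analyticOnNhd Λ β n k x (hUD hx)).differentiableAt.hasDerivAt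
      · rw [iteratedDeriv_succ, iteratedDeriv_eq_iterate]
        exact ((hf x hx).iterated_deriv k).differentiableAt.hasDerivAt
    rw [ladder, lower_congr hU ih hx, lower, hd.deriv]
    have e1 : ∀ k, ladderCoeff Λ β (n + 1) (k + 1) x * iteratedDeriv (k + 1) f x =
        ladderCoeff Λ β n k x * iteratedDeriv (k + 1) f x +
        (deriv (ladderCoeff Λ β n (k + 1)) x -
          logDer Λ (fun i => β i + n) x * ladderCoeff Λ β n (k + 1) x) *
            iteratedDeriv (k + 1) f x := by
      intro k; rw [ladderCoeff]; ring
    have e2 : ladderCoeff Λ β (n + 1) 0 x * iteratedDeriv 0 f x =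
        (deriv (ladderCoeff Λ β n 0) x -
          logDer Λ (fun i => β i + n) x * ladderCoeff Λ β n 0 x) * iteratedDeriv 0 f x := by
      rw [ladderCoeff]
    have e3 : ∑ k ∈ Finset.range (n + 1 + 1),
        ladderCoeff Λ β (n + 1) k x * iteratedDeriv k f x =
        ∑ k ∈ Finset.range (n + 1), ladderCoeff Λ β n k x * iteratedDeriv (k + 1) f x +
        ∑ k ∈ Finset.range (n + 1), (deriv (ladderCoeff Λ β n k) x -
          logDer Λ (fun i => β i + n) x * ladderCoeff Λ β n k x) * iteratedDeriv k f x := by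
      rw [Finset.sum_range_succ', e2, Finset.sum_congr rfl fun k _ => e1 k,
        Finset.sum_add_distrib, add_assoc,
        ← Finset.sum_range_succ' (fun k => (deriv (ladderCoeff Λ β n k) x -
          logDer Λ (fun i => β i + n) x * ladderCoeff Λ β n k x) * iteratedDeriv k f x) (n + 1),
        Finset.sum_range_succ _ (n + 1), ladderCoeff_eq_zero n.lt_succ_self]
      simp
    simp only [e3, sub_mul, Finset.sum_sub_distrib, Finset.mul_sum, Finset.sum_add_distrib,
      mul_assoc]
    ring

/-- The monic operator of order `d + 1` annihilating `V_α`. -/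
def annihilator (Λ : PeriodPair) (β : Fin 3 → ℂ) (n : ℕ) : MonicDiffOp (regularSet Λ) n where
  coeff k := ladderCoeff Λ β n k
  analytic k := ladderCoeff_analyticOnNhd Λ β n k

lemma act_annihilator (hU : IsOpen U) (hUD : U ⊆ regularSet Λ) (hf : AnalyticOnNhd ℂ f U)
    (n : ℕ) : Set.EqOn ((annihilator Λ β n).act f) (ladder Λ β n f) U := by
  intro x hx
  rw [ladder_eq_sum hU hUD hf n hx]
  simp only []
  rw [Finset.sum_range_succ, ladderCoeff_self,
    ← Fin.sum_univ_eq_sum_range (fun k => ladderCoeff Λ β n k x * iteratedDeriv k f x)]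
  simp [MonicDiffOp.act, annihilator, add_comm]

end Coefficients

/-! ### Annihilation of `V_α` and the intertwining relation. -/

section QuasiSolvable

variable {Λ : PeriodPair} {l α : Fin 4 → ℂ} {d : ℕ} {U : Set ℂ} {Φ f : ℂ → ℂ}

lemma hamiltonian_eq_ladderHam (h : ∀ i, l i * (l i + 1) = α i * (α i - 1)) :
    hamiltonian Λ l = ladderHam Λ (fun i => α i.succ) (α 0 * (α 0 - 1)) := by
  ext f x
  rw [hamiltonian, ladderHam, potential, Fin.sum_univ_succ]
  simp only [h, shiftP]
  simp [halfPeriod, add_comm]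

lemma mem_quasiSolvableSpace_iff :
    f ∈ quasiSolvableSpace Λ d Φ ↔ ∃ p ∈ Polynomial.degreeLT ℂ (d + 1),
      f = fun x => Φ x * p.eval (Λ.weierstrassP x) := by
  let ev : Polynomial ℂ →ₗ[ℂ] (ℂ → ℂ) :=
    { toFun := fun p x => Φ x * p.eval (Λ.weierstrassP x)
      map_add' := fun p q => by ext x; simp [mul_add]
      map_smul' := fun c p => by ext x; simp; ring }
  have : quasiSolvableSpace Λ d Φ = (Polynomial.degreeLT ℂ (d + 1)).map ev := by
    rw [Polynomial.degreeLT_eq_span_X_pow, Submodule.map_span, quasiSolvableSpace]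
    congr 1
    ext g
    constructor
    · rintro ⟨n, rfl⟩
      exact ⟨Polynomial.X ^ (n : ℕ), by simpa using ⟨n, n.is_le, rfl⟩, by ext x; simp [ev]⟩
    · rintro ⟨p, hp, rfl⟩
      simp only [Finset.coe_image, Finset.coe_range, Set.mem_image, Set.mem_Iio] at hp
      obtain ⟨n, hn, rfl⟩ := hp
      exact ⟨⟨n, hn⟩, by ext x; simp [ev]⟩
  rw [this, Submodule.mem_map]
  exact ⟨fun ⟨p, hp, e⟩ => ⟨p, hp, e.symm⟩, fun ⟨p, hp, e⟩ => ⟨p, hp, e.symm⟩⟩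

lemma annihilatesSpace_annihilator (Λ : PeriodPair) (α : Fin 4 → ℂ) (d : ℕ) :
    AnnihilatesSpace Λ α d (annihilator Λ (fun i => α i.succ) (d + 1)) := by
  intro U Φ hU hUD hΦ f hf x hx
  obtain ⟨p, hp, rfl⟩ := mem_quasiSolvableSpace_iff.1 hf
  have hg := hΦ.isGauge hU hUD
  rw [act_annihilator hU hUD (DifferentiableOn.analyticOnNhd (fun x hx =>
      ((hg x hx).2.differentiableAt.fun_mul
        (hasDerivAt_eval_weierstrassP p (hUD hx)).differentiableAt).differentiableWithinAt) hU)
      _ hx, ladder_gauge_eval hg hU hUD p _ hx,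
    Polynomial.iterate_derivative_eq_zero_of_degree_lt
      (by simpa using Polynomial.mem_degreeLT.1 hp)]
  simp

lemma intertwining (h : ∀ i, l i * (l i + 1) = α i * (α i - 1))
    (hd : (d : ℂ) = -(∑ i, α i) / 2) (hU : IsOpen U) (hUD : U ⊆ regularSet Λ)
    (hf : AnalyticOnNhd ℂ f U) :
    Set.EqOn (hamiltonian Λ (fun i => α i + d)
        ((annihilator Λ (fun i => α i.succ) (d + 1)).act f))
      ((annihilator Λ (fun i => α i.succ) (d + 1)).act (hamiltonian Λ l f)) U := by
  intro x hx
  have hs : ∑ i : Fin 3, α i.succ = -2 * d - α 0 := by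
    rw [Fin.sum_univ_succ] at hd
    linear_combination 2 * hd
  -- With `t = s + 2(n - 1)` the scalar is `n(m - t² - t)`; here `t = s + 2d = -α₀`, so it vanishes.
  have hdef : defect (fun i => α i.succ) (α 0 * (α 0 - 1)) (d + 1) = 0 := by
    rw [defect, hs]; push_cast; ring
  -- The coefficient of `℘` thus ends at exponent `α₀ + d + 1`, the same shift as in the other three
  -- exponents.
  have hch : chainCoeff (fun i => α i.succ) (α 0 * (α 0 - 1)) (d + 1) =
      (α 0 + d + 1) * (α 0 + d + 1 - 1) := by
    rw [chainCoeff, hs]; push_cast; ring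
  rw [hamiltonian_eq_ladderHam h, hamiltonian_eq_ladderHam (l := fun i => α i + d)
    (α := fun i => α i + d + 1) (fun i => by ring),
    act_annihilator hU hUD (ladderHam_analyticOnNhd hf hUD _) _ hx,
    ladder_ladderHam hU hUD hf _ _ hx, hdef, hch,
    ladderHam_congr hU (act_annihilator hU hUD hf (d + 1)) _ hx]
  push_cast
  simp only [add_assoc, zero_mul, add_zero]

end QuasiSolvable

/-! ### Uniqueness of the annihilating operator. -/

section Uniqueness

variable {Λ : PeriodPair} {α : Fin 4 → ℂ} {d : ℕ}

/-- `Φ (℘ - ℘(x₀))ᵐ` vanishes to order exactly `m` at `x₀`, since `Φ` and `℘'` are nonzero there. -/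
lemma exists_mem_quasiSolvableSpace_iteratedDeriv {U : Set ℂ} {Φ : ℂ → ℂ} {x₀ : ℂ}
    (hU : IsOpen U) (hUD : U ⊆ regularSet Λ) (hΦ : IsBranch Λ α U Φ) (hx₀ : x₀ ∈ U) {m : ℕ}
    (hm : m ≤ d) :
    ∃ f ∈ quasiSolvableSpace Λ d Φ, (∀ k < m, iteratedDeriv k f x₀ = 0) ∧
      iteratedDeriv m f x₀ ≠ 0 := by
  have hg := hΦ.isGauge hU hUD
  set z₀ := Λ.weierstrassP x₀
  have haΦ := hg.analyticOnNhd hU x₀ hx₀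
  have haP : AnalyticAt ℂ (fun x => Λ.weierstrassP x - z₀) x₀ :=
    (analyticOnNhd_weierstrassP Λ x₀ (hUD hx₀)).sub analyticAt_const
  have hdP : HasDerivAt (fun x => Λ.weierstrassP x - z₀) (Λ.derivWeierstrassP x₀) x₀ :=
    (hasDerivAt_weierstrassP (notMem_lattice (hUD hx₀))).sub_const z₀
  have ho1 : analyticOrderAt (fun x => Λ.weierstrassP x - z₀) x₀ = 1 := by
    have h1 := haP.analyticOrderAt_deriv_add_one
    have h2 : analyticOrderAt (deriv fun x => Λ.weierstrassP x - z₀) x₀ = 0 := by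
      rw [haP.deriv.analyticOrderAt_eq_zero, hdP.deriv]
      exact derivWeierstrassP_ne_zero (hUD hx₀)
    rw [h2] at h1
    simpa [z₀] using h1.symm
  set f : ℂ → ℂ := fun x => Φ x * (Λ.weierstrassP x - z₀) ^ m with hf
  have haf : AnalyticAt ℂ f x₀ := haΦ.mul (haP.pow m)
  have hof : analyticOrderAt f x₀ = m := by
    have : f = Φ * (fun x => Λ.weierstrassP x - z₀) ^ m := rfl
    rw [this, analyticOrderAt_mul haΦ (haP.pow m), analyticOrderAt_pow haP, ho1,
      haΦ.analyticOrderAt_eq_zero.2 (hg x₀ hx₀).1]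
    simp
  have hlt := (natCast_le_analyticOrderAt_iff_iteratedDeriv_eq_zero (n := m) haf).1 hof.ge
  refine ⟨f, mem_quasiSolvableSpace_iff.2
    ⟨(Polynomial.X - Polynomial.C z₀) ^ m, ?_, by ext x; simp [hf]⟩, hlt, fun H => ?_⟩
  · rw [Polynomial.mem_degreeLT, Polynomial.degree_pow, Polynomial.degree_X_sub_C]
    simpa using mod_cast Nat.lt_succ_of_le hm
  · have := (natCast_le_analyticOrderAt_iff_iteratedDeriv_eq_zero (n := m + 1) haf).2
      (fun i hi => by
        rcases Nat.lt_succ_iff_lt_or_eq.1 hi with h | rfl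
        · exact hlt i h
        · exact H)
    rw [hof] at this
    exact absurd (mod_cast this : m + 1 ≤ m) (by omega)

lemma AnnihilatesSpace.eqOn_coeff {L L' : MonicDiffOp (regularSet Λ) (d + 1)}
    (hL : AnnihilatesSpace Λ α d L) (hL' : AnnihilatesSpace Λ α d L') (k : Fin (d + 1)) :
    Set.EqOn (L'.coeff k) (L.coeff k) (regularSet Λ) := by
  intro x₀ hx₀
  obtain ⟨r, hr, Φ, hUD, -, hΦ⟩ := exists_isBranch α hx₀ univ_mem
  have hxU := Metric.mem_ball_self (x := x₀) hr
  have hzero : ∀ f ∈ quasiSolvableSpace Λ d Φ,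
      ∑ k, (L'.coeff k x₀ - L.coeff k x₀) * iteratedDeriv (k : ℕ) f x₀ = 0 := by
    intro f hf
    have h1 := hL _ Φ Metric.isOpen_ball hUD hΦ f hf x₀ hxU
    have h2 := hL' _ Φ Metric.isOpen_ball hUD hΦ f hf x₀ hxU
    rw [MonicDiffOp.act] at h1 h2
    simp only [sub_mul, Finset.sum_sub_distrib]
    linear_combination h2 - h1
  -- On functions of vanishing order exactly `k`, the relation `hzero` is a triangular system,
  -- solved from the top coefficient downwards.
  have main : ∀ j : ℕ, ∀ k : Fin (d + 1), d - k ≤ j → L'.coeff k x₀ - L.coeff k x₀ = 0 := by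
    intro j
    induction j using Nat.strong_induction_on with
    | _ j ih =>
      intro k hk
      obtain ⟨f, hf, hlt, hne⟩ := exists_mem_quasiSolvableSpace_iteratedDeriv
        Metric.isOpen_ball hUD hΦ hxU (Nat.le_of_lt_succ k.2)
      have h1 := hzero f hf
      rw [Finset.sum_eq_single k] at h1
      · exact (mul_eq_zero.1 h1).resolve_right hne
      · intro i _ hik
        rcases lt_or_gt_of_ne hik with h | h
        · rw [hlt i h, mul_zero]
        · have h' : (k : ℕ) < i := h
          rw [ih (d - i) (by omega) i le_rfl, zero_mul]
      · simp
  exact sub_eq_zero.1 (main _ k le_rfl)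

end Uniqueness

/-! ### Tridiagonal matrices and reversal of the basis. -/

section Tridiagonal

/-- The tridiagonal matrix of the operator `eⱼ ↦ Aⱼ eⱼ₊₁ + Bⱼ eⱼ + Cⱼ eⱼ₋₁`. -/
def tridiagonal (A B C : ℕ → ℂ) (n : ℕ) : Matrix (Fin n) (Fin n) ℂ := fun i j =>
  (if (i : ℕ) = j + 1 then A j else 0) + (if (i : ℕ) = j then B j else 0) +
    (if (i : ℕ) + 1 = j then C j else 0)

/-- `A d = 0` and `C 0 = 0` say that cutting the infinite band down to size `d + 1` loses nothing;
`C 0 = 0` also covers the truncated exponent at `j = 0`. -/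
lemma sum_tridiagonal_mul_pow {A B C : ℕ → ℂ} {d : ℕ} (hA : A d = 0) (hC : C 0 = 0)
    (j : Fin (d + 1)) (w : ℂ) :
    ∑ i, tridiagonal A B C (d + 1) i j * w ^ (i : ℕ) =
      A j * w ^ ((j : ℕ) + 1) + B j * w ^ (j : ℕ) + C j * w ^ ((j : ℕ) - 1) := by
  obtain ⟨j, hj⟩ := j
  simp only [tridiagonal]
  rw [Fin.sum_univ_eq_sum_range (fun i => ((if i = j + 1 then A j else 0) +
    (if i = j then B j else 0) + (if i + 1 = j then C j else 0)) * w ^ i) (d + 1)]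
  simp only [add_mul, ite_mul, zero_mul, Finset.sum_add_distrib]
  congr 1
  · congr 1
    · rw [Finset.sum_ite_eq']
      rcases eq_or_ne j d with rfl | h
      · simp [hA]
      · rw [if_pos]; simp; omega
    · rw [Finset.sum_ite_eq', if_pos (by simpa using hj)]
  · rcases j with - | j
    · simp [hC]
    · simp only [Nat.add_right_cancel_iff, Finset.sum_ite_eq', Nat.add_sub_cancel]
      rw [if_pos]; simp; omega

/-- Two tridiagonal matrices related by a reversal of the basis and a transposition, up to
conjugation by a diagonal matrix, have the same eigenvalues. -/
lemma exists_eigenvector_iff_of_reverse {A B C A' B' C' : ℕ → ℂ} {d : ℕ} {δ : ℕ → ℂ}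
    (hδ : ∀ n ≤ d, δ n ≠ 0) (hB : ∀ n ≤ d, B n = B' (d - n))
    (hA : ∀ n < d, δ (n + 1) * A n = A' (d - (n + 1)) * δ n)
    (hC : ∀ n < d, δ n * C (n + 1) = C' (d - n) * δ (n + 1)) (E : ℂ) :
    (∃ v, v ≠ 0 ∧ (tridiagonal A B C (d + 1)).mulVec v = E • v) ↔
      ∃ v, v ≠ 0 ∧ (tridiagonal A' B' C' (d + 1)).mulVec v = E • v := by
  set M := tridiagonal A B C (d + 1)
  set M' := tridiagonal A' B' C' (d + 1)
  have key : ∀ N : Matrix (Fin (d + 1)) (Fin (d + 1)) ℂ,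
      (∃ v, v ≠ 0 ∧ N.mulVec v = E • v) ↔ (N - E • 1).det = 0 := by
    intro N
    rw [← Matrix.exists_mulVec_eq_zero_iff]
    simp only [Matrix.sub_mulVec, Matrix.smul_mulVec, Matrix.one_mulVec, sub_eq_zero]
  rw [key, key]
  set D : Matrix (Fin (d + 1)) (Fin (d + 1)) ℂ := Matrix.diagonal fun i => δ i
  have hD : D.det ≠ 0 := by
    rw [Matrix.det_diagonal]
    exact Finset.prod_ne_zero_iff.2 fun i _ => hδ i i.is_le
  have h1 : D * M = (M'.submatrix Fin.rev Fin.rev).transpose * D := by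
    ext i j
    rw [Matrix.diagonal_mul, Matrix.mul_diagonal, Matrix.transpose_apply, Matrix.submatrix_apply]
    obtain ⟨i, hi⟩ := i
    obtain ⟨j, hj⟩ := j
    simp only [M, M', tridiagonal, Fin.val_rev]
    by_cases h1 : i = j + 1
    · subst h1
      have e : d + 1 - (j + 1) = d + 1 - (j + 1 + 1) + 1 := by omega
      have := hA j (by omega)
      have ne : ∀ n : ℕ, n + 1 + 1 ≠ n := by omega
      simpa [e, ne] using this
    by_cases h2 : i = j
    · subst h2
      have := hB i (by omega)
      simp [this]
      ring
    by_cases h3 : i + 1 = j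
    · subst h3
      have := hC i (by omega)
      have e : d + 1 - (i + 1) = d + 1 - (i + 1 + 1) + 1 := by omega
      have e' : d - (i + 1) + 1 = d - i := by omega
      have ne : i ≠ i + 1 + 1 := by omega
      have ne' : d - (i + 1) ≠ d - i + 1 := by omega
      have ne'' : d - (i + 1) ≠ d - i := by omega
      simpa [e, e', ne, ne', ne''] using this
    · have n1 : d + 1 - (j + 1) ≠ d + 1 - (i + 1) + 1 := by omega
      have n2 : d + 1 - (j + 1) ≠ d + 1 - (i + 1) := by omega
      have n3 : d + 1 - (j + 1) + 1 ≠ d + 1 - (i + 1) := by omega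
      simp only [h1, h2, h3, n1, n2, n3, if_false]
      ring
  have h2 : D * (M - E • 1) = ((M' - E • 1).submatrix Fin.rev Fin.rev).transpose * D := by
    have : ((M' - E • 1).submatrix Fin.rev Fin.rev).transpose =
        (M'.submatrix Fin.rev Fin.rev).transpose - E • 1 := by
      ext i j
      simp [Matrix.one_apply, eq_comm]
    rw [this, mul_sub, sub_mul, h1]
    simp
  have h3 := congrArg Matrix.det h2
  rw [Matrix.det_mul, Matrix.det_mul, Matrix.det_transpose,
    show (Fin.rev : Fin (d + 1) → Fin (d + 1)) = Fin.revPerm from rfl,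
    Matrix.det_submatrix_equiv_self, mul_comm] at h3
  rw [mul_right_cancel₀ hD h3]

end Tridiagonal

/-! ### The matrix of `H` on `V_α`. -/

section GaugeMatrix

variable {Λ : PeriodPair} {β : Fin 3 → ℂ} {U : Set ℂ} {Φ : ℂ → ℂ} {x : ℂ} {m : ℂ} {d : ℕ}

/-- The coefficient of `wⁿ⁺¹` in the gauge transform of the Hamiltonian applied to `wⁿ`,
`w = ℘ - e₁`. -/
def upCoeff (β : Fin 3 → ℂ) (m : ℂ) (n : ℕ) : ℂ :=
  m - (∑ i, β i) ^ 2 - ∑ i, β i - (4 * n ^ 2 + (2 + 4 * ∑ i, β i) * n)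

/-- The coefficient of `wⁿ` in the gauge transform of the Hamiltonian applied to `wⁿ`. -/
def diagCoeff (Λ : PeriodPair) (β : Fin 3 → ℂ) (m : ℂ) (n : ℕ) : ℂ :=
  4 * n ^ 2 * (root Λ 1 - root Λ 0 + (root Λ 2 - root Λ 0)) +
    4 * n * (β 0 * (root Λ 1 - root Λ 0 + (root Λ 2 - root Λ 0)) +
      β 1 * (root Λ 2 - root Λ 0) + β 2 * (root Λ 1 - root Λ 0)) +
    (m - (∑ i, β i) ^ 2 - ∑ i, β i) * root Λ 0 + riccatiConst Λ β

/-- The coefficient of `wⁿ⁻¹` in the gauge transform of the Hamiltonian applied to `wⁿ`. -/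
def downCoeff (Λ : PeriodPair) (β : Fin 3 → ℂ) (n : ℕ) : ℂ :=
  -((root Λ 1 - root Λ 0) * (root Λ 2 - root Λ 0) * n * (4 * n - 2 + 4 * β 0))

/-- The gauge transform of the Schrödinger operator. -/
lemma ladderHam_gauge_mul {u u' u'' : ℂ → ℂ} (h : IsGauge Λ β U Φ) (hU : IsOpen U)
    (hUD : U ⊆ regularSet Λ) (hu : ∀ y ∈ U, HasDerivAt u (u' y) y)
    (hu' : ∀ y ∈ U, HasDerivAt u' (u'' y) y) (hx : x ∈ U) :
    ladderHam Λ β m (fun y => Φ y * u y) x = Φ x * (-u'' x - 2 * logDer Λ β x * u' x +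
      ((m - (∑ i, β i) ^ 2 - ∑ i, β i) * Λ.weierstrassP x + riccatiConst Λ β) * u x) := by
  have e1 : Set.EqOn (deriv fun y => Φ y * u y)
      (fun y => logDer Λ β y * Φ y * u y + Φ y * u' y) U := fun y hy =>
    ((h y hy).2.fun_mul (hu y hy)).deriv
  have hd := ((((hasDerivAt_logDer β (hUD hx)).fun_mul (h x hx).2).fun_mul (hu x hx)).fun_add
    ((h x hx).2.fun_mul (hu' x hx))).deriv
  rw [ladderHam, iteratedDeriv_two', e1.deriv hU hx, hd, sum_shiftP_eq_riccati β (hUD hx)]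
  ring

/-- With `w = ℘ - e₁`, the functions `℘'²`, `℘''` and `χ℘'` are polynomials in `w`. Centring at a
root makes `w` divide `℘'²`, so only three neighbouring powers occur. -/
lemma ladderHam_gauge_pow (h : IsGauge Λ β U Φ) (hU : IsOpen U)
    (hUD : U ⊆ regularSet Λ) (n : ℕ) (hx : x ∈ U) :
    ladderHam Λ β m (fun y => Φ y * (Λ.weierstrassP y - root Λ 0) ^ n) x =
      Φ x * (upCoeff β m n * (Λ.weierstrassP x - root Λ 0) ^ (n + 1) +
        diagCoeff Λ β m n * (Λ.weierstrassP x - root Λ 0) ^ n +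
        downCoeff Λ β n * (Λ.weierstrassP x - root Λ 0) ^ (n - 1)) := by
  have hw : ∀ y ∈ U, HasDerivAt (fun y => Λ.weierstrassP y - root Λ 0)
      (Λ.derivWeierstrassP y) y := fun y hy =>
    (hasDerivAt_weierstrassP (notMem_lattice (hUD hy))).sub_const _
  have hs := derivWeierstrassP_sq_eq (notMem_lattice (hUD hx))
  have hl := logDer_mul_derivWeierstrassP β (hUD hx)
  rw [ladderHam_gauge_mul h hU hUD (fun y hy => (hw y hy).fun_pow n) (fun y hy =>
    (((hw y hy).fun_pow (n - 1)).const_mul (n : ℂ)).fun_mul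
      (hasDerivAt_derivWeierstrassP (hUD hy))) hx]
  congr 1
  simp only [upCoeff, diagCoeff, downCoeff, Fin.sum_univ_three]
  obtain ⟨w, hwx⟩ : ∃ w, w = Λ.weierstrassP x - root Λ 0 := ⟨_, rfl⟩
  have e0 : Λ.weierstrassP x = w + root Λ 0 := by rw [hwx]; ring
  rw [e0] at hs hl ⊢
  simp only [add_sub_cancel_right] at hs hl ⊢
  -- The cases `0` and `1` are separate because the second derivative of `wⁿ` involves `w^(n-2)`.
  rcases n with - | - | n
  · simp; ring
  · simp
    linear_combination -2 * hl
  · simp only [Nat.add_sub_cancel]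
    push_cast
    linear_combination -(n + 2) * (n + 1) * w ^ n * hs - 2 * (n + 2) * w ^ (n + 1) * hl

lemma ladderHam_sum {ι : Type*} (s : Finset ι) (F : ι → ℂ → ℂ) (c : ι → ℂ)
    (hF : ∀ i, AnalyticAt ℂ (F i) x) :
    ladderHam Λ β m (fun y => ∑ i ∈ s, c i * F i y) x = ∑ i ∈ s, c i * ladderHam Λ β m (F i) x := by
  rw [ladderHam, iteratedDeriv_fun_sum (f := fun i y => c i * F i y)
    fun i _ => (analyticAt_const.mul (hF i)).contDiffAt]
  simp only [iteratedDeriv_const_mul_field, ladderHam, mul_add, Finset.sum_add_distrib,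
    Finset.mul_sum, mul_neg, Finset.sum_neg_distrib]
  congr 1
  exact Finset.sum_congr rfl fun i _ => by ring

/-- The matrix of the gauge transform of the Hamiltonian on polynomials of degree `≤ d`. -/
def gaugeMatrix (Λ : PeriodPair) (β : Fin 3 → ℂ) (m : ℂ) (d : ℕ) :
    Matrix (Fin (d + 1)) (Fin (d + 1)) ℂ :=
  tridiagonal (upCoeff β m) (diagCoeff Λ β m) (downCoeff Λ β) (d + 1)

lemma ladderHam_gauge_sum (h : IsGauge Λ β U Φ) (hU : IsOpen U) (hUD : U ⊆ regularSet Λ)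
    (hm : upCoeff β m d = 0) (c : Fin (d + 1) → ℂ) (hx : x ∈ U) :
    ladderHam Λ β m
        (fun y => Φ y * ∑ j, c j * (Λ.weierstrassP y - root Λ 0) ^ (j : ℕ)) x =
      Φ x * ∑ i, (gaugeMatrix Λ β m d).mulVec c i *
        (Λ.weierstrassP x - root Λ 0) ^ (i : ℕ) := by
  have e1 : (fun y => Φ y * ∑ j, c j * (Λ.weierstrassP y - root Λ 0) ^ (j : ℕ)) =
      fun y => ∑ j, c j * (Φ y * (Λ.weierstrassP y - root Λ 0) ^ (j : ℕ)) := by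
    ext y
    rw [Finset.mul_sum]
    exact Finset.sum_congr rfl fun i _ => by ring
  rw [e1, ladderHam_sum _ (fun (j : Fin (d + 1)) y => Φ y * (Λ.weierstrassP y - root Λ 0) ^ (j : ℕ)) _
    fun j => (h.analyticOnNhd hU x hx).mul
    (((analyticOnNhd_weierstrassP Λ x (hUD hx)).sub analyticAt_const).pow _)]
  simp only [ladderHam_gauge_pow h hU hUD _ hx, Matrix.mulVec, dotProduct, Finset.sum_mul]
  rw [Finset.sum_comm, Finset.mul_sum]
  refine Finset.sum_congr rfl fun j _ => ?_
  rw [← sum_tridiagonal_mul_pow hm (by simp [downCoeff]), Finset.mul_sum, Finset.mul_sum,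
    Finset.mul_sum]
  exact Finset.sum_congr rfl fun i _ => by rw [gaugeMatrix]; ring

lemma mem_quasiSolvableSpace_iff_sum {f : ℂ → ℂ} (a : ℂ) :
    f ∈ quasiSolvableSpace Λ d Φ ↔ ∃ c : Fin (d + 1) → ℂ,
      f = fun x => Φ x * ∑ j, c j * (Λ.weierstrassP x - a) ^ (j : ℕ) := by
  rw [mem_quasiSolvableSpace_iff]
  constructor
  · rintro ⟨p, hp, rfl⟩
    have hp' : Polynomial.taylor a p ∈ Polynomial.degreeLT ℂ (d + 1) := by
      rw [Polynomial.mem_degreeLT] at hp ⊢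
      rwa [Polynomial.degree_taylor]
    refine ⟨Polynomial.degreeLTEquiv ℂ (d + 1) ⟨_, hp'⟩, ?_⟩
    ext x
    rw [← Polynomial.eval_eq_sum_degreeLTEquiv hp', Polynomial.taylor_eval, sub_add_cancel]
  · rintro ⟨c, rfl⟩
    set q := (Polynomial.degreeLTEquiv ℂ (d + 1)).symm c with hq
    refine ⟨Polynomial.taylor (-a) q, ?_, ?_⟩
    · have := q.2
      rw [Polynomial.mem_degreeLT] at this ⊢
      rwa [Polynomial.degree_taylor]
    · ext x
      rw [Polynomial.taylor_eval, ← sub_eq_add_neg, Polynomial.eval_eq_sum_degreeLTEquiv q.2]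
      simp [hq]

/-- As `℘' ≠ 0`, the image of `U` under `℘` contains an open set, on which the polynomial would have
infinitely many roots. -/
lemma eq_zero_of_sum_weierstrassP_eq_zero (hU : IsOpen U) (hUD : U ⊆ regularSet Λ)
    (hne : U.Nonempty) (a : ℂ) {n : ℕ} (c : Fin n → ℂ)
    (h : ∀ x ∈ U, ∑ j, c j * (Λ.weierstrassP x - a) ^ (j : ℕ) = 0) : c = 0 := by
  obtain ⟨x, hx⟩ := hne
  have hs : HasStrictDerivAt (fun y => Λ.weierstrassP y - a) (Λ.derivWeierstrassP x) x := by
    have h1 := (analyticOnNhd_weierstrassP Λ x (hUD hx)).hasStrictDerivAt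
    rw [Λ.deriv_weierstrassP] at h1
    exact h1.sub_const a
  have hmap := hs.map_nhds_eq (derivWeierstrassP_ne_zero (hUD hx))
  set q := (Polynomial.degreeLTEquiv ℂ n).symm c with hq
  have heval : ∀ z, (q : Polynomial ℂ).eval z = ∑ j, c j * z ^ (j : ℕ) := by
    intro z
    rw [Polynomial.eval_eq_sum_degreeLTEquiv q.2]
    simp [hq]
  have hev : ∀ᶠ z in 𝓝 (Λ.weierstrassP x - a), (q : Polynomial ℂ).IsRoot z := by
    rw [← hmap, eventually_map]
    filter_upwards [hU.mem_nhds hx] with y hy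
    rw [Polynomial.IsRoot, heval]
    exact h y hy
  have h0 : (q : Polynomial ℂ) = 0 :=
    Polynomial.eq_zero_of_infinite_isRoot _ (infinite_of_mem_nhds _ hev)
  have : q = 0 := Subtype.ext h0
  rwa [hq, LinearEquiv.map_eq_zero_iff] at this

end GaugeMatrix

/-! ### Invariance of `V_α` and the duality of exceptional values. -/

section Eigenvalues

variable {Λ : PeriodPair} {l α : Fin 4 → ℂ} {d : ℕ}

/-- At `n` the coefficient is `m - t² - t` with `t = s + 2n`, and `t = -α₀` when `n = d`. -/
lemma upCoeff_eq_zero (hd : (d : ℂ) = -(∑ i, α i) / 2) :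
    upCoeff (fun i => α i.succ) (α 0 * (α 0 - 1)) d = 0 := by
  have hs : ∑ i : Fin 3, α i.succ = -2 * d - α 0 := by
    rw [Fin.sum_univ_succ] at hd
    linear_combination 2 * hd
  rw [upCoeff, hs]
  ring

lemma preservesSpace (h : ∀ i, l i * (l i + 1) = α i * (α i - 1))
    (hd : (d : ℂ) = -(∑ i, α i) / 2) : PreservesSpace Λ l α d := by
  intro U Φ hU hUD hΦ f hf
  obtain ⟨c, rfl⟩ := (mem_quasiSolvableSpace_iff_sum (root Λ 0)).1 hf
  refine ⟨_, (mem_quasiSolvableSpace_iff_sum (root Λ 0)).2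
    ⟨(gaugeMatrix Λ (fun i => α i.succ) (α 0 * (α 0 - 1)) d).mulVec c, rfl⟩, fun x hx => ?_⟩
  rw [hamiltonian_eq_ladderHam h]
  exact ladderHam_gauge_sum (hΦ.isGauge hU hUD) hU hUD (upCoeff_eq_zero hd) c hx

/-- The matrix involves neither the open set nor the branch, so being an eigenvalue does not depend
on them. -/
lemma isEigenvalueOnSpace_iff (h : ∀ i, l i * (l i + 1) = α i * (α i - 1))
    (hd : (d : ℂ) = -(∑ i, α i) / 2) (E : ℂ) :
    IsEigenvalueOnSpace Λ l α d E ↔ ∃ v, v ≠ 0 ∧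
      (gaugeMatrix Λ (fun i => α i.succ) (α 0 * (α 0 - 1)) d).mulVec v = E • v := by
  constructor
  · rintro ⟨U, Φ, hU, hUc, hUD, hΦ, f, hf, ⟨x, hx, hfx⟩, hE⟩
    obtain ⟨c, rfl⟩ := (mem_quasiSolvableSpace_iff_sum (root Λ 0)).1 hf
    have hg := hΦ.isGauge hU hUD
    refine ⟨c, ?_, ?_⟩
    · rintro rfl
      simp at hfx
    · rw [← sub_eq_zero]
      refine eq_zero_of_sum_weierstrassP_eq_zero hU hUD ⟨x, hx⟩ (root Λ 0) _ fun y hy => ?_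
      have := hE y hy
      rw [hamiltonian_eq_ladderHam h, ladderHam_gauge_sum hg hU hUD (upCoeff_eq_zero hd) c hy]
        at this
      have h2 := mul_left_cancel₀ (hg y hy).1 (this.trans (mul_left_comm _ _ _))
      simp only [Pi.sub_apply, Pi.smul_apply, smul_eq_mul, sub_mul, Finset.sum_sub_distrib,
        mul_assoc, ← Finset.mul_sum]
      rw [h2, sub_self]
  · rintro ⟨v, hv, hE⟩
    obtain ⟨x₀, hx₀⟩ := (isConnected_regularSet Λ).nonempty
    obtain ⟨r, hr, Φ, hUD, -, hΦ⟩ := exists_isBranch α hx₀ univ_mem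
    have hU := Metric.isOpen_ball (x := x₀) (ε := r)
    have hg := hΦ.isGauge hU hUD
    have hne : (Metric.ball x₀ r).Nonempty := Metric.nonempty_ball.2 hr
    refine ⟨_, Φ, hU, (convex_ball x₀ r).isConnected hne, hUD, hΦ, _,
      (mem_quasiSolvableSpace_iff_sum (root Λ 0)).2 ⟨v, rfl⟩, ?_, fun x hx => ?_⟩
    · by_contra! H
      exact hv (eq_zero_of_sum_weierstrassP_eq_zero hU hUD hne (root Λ 0) v fun x hx =>
        (mul_eq_zero.1 (H x hx)).resolve_left (hg x hx).1)
    · rw [hamiltonian_eq_ladderHam h, ladderHam_gauge_sum hg hU hUD (upCoeff_eq_zero hd) v hx, hE]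
      simp only [Pi.smul_apply, smul_eq_mul, mul_assoc, ← Finset.mul_sum]
      ring

lemma isEigenvalueOnSpace_iff_dual (h : ∀ i, l i * (l i + 1) = α i * (α i - 1))
    (hd : (d : ℂ) = -(∑ i, α i) / 2) (E : ℂ) :
    IsEigenvalueOnSpace Λ l α d E ↔
      IsEigenvalueOnSpace Λ (fun i => α i + d) (fun i => -α i - d) d E := by
  have hd' : (d : ℂ) = -(∑ i, (-α i - d)) / 2 := by
    rw [Fin.sum_univ_four] at hd ⊢
    linear_combination -hd
  rw [isEigenvalueOnSpace_iff h hd, isEigenvalueOnSpace_iff (fun i => by ring) hd']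
  have hα0 : α 0 = -2 * d - α 1 - α 2 - α 3 := by
    rw [Fin.sum_univ_four] at hd
    linear_combination 2 * hd
  have hr : root Λ 2 = -root Λ 0 - root Λ 1 := by linear_combination root_sum Λ
  -- The upper coefficients are `-2(d-n)(2α₀+2(d-n)-1)`, and the dual ones at `d-n-1` are
  -- `2(n+1)(2α₀+2(d-n)-1)`. This forces `δ (n+1) / δ n = -(n+1)/(d-n)`, solved by `(-1)ⁿ n!
  -- (d-n)!`.
  refine exists_eigenvector_iff_of_reverse (d := d)
    (δ := fun n => (-1) ^ n * (n.factorial : ℂ) * ((d - n).factorial : ℂ)) ?_ ?_ ?_ ?_ E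
  · intro n _
    have h1 : (n.factorial : ℂ) ≠ 0 := by exact_mod_cast n.factorial_ne_zero
    have h2 : ((d - n).factorial : ℂ) ≠ 0 := by exact_mod_cast (d - n).factorial_ne_zero
    simp [h1, h2]
  · intro n hn
    simp only [diagCoeff, riccatiConst, Fin.sum_univ_three, Nat.cast_sub hn, hα0, hr,
      Fin.succ_zero_eq_one, Fin.succ_one_eq_two, show (Fin.succ 2 : Fin 4) = 3 from rfl]
    ring
  · intro n hn
    obtain ⟨k, rfl⟩ : ∃ k, d = n + 1 + k := ⟨d - (n + 1), by omega⟩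
    have e1 : n + 1 + k - n = k + 1 := by omega
    simp only [e1, Nat.add_sub_cancel_left, Nat.factorial_succ, upCoeff, Fin.sum_univ_three, hα0,
      Fin.succ_zero_eq_one, Fin.succ_one_eq_two, show (Fin.succ 2 : Fin 4) = 3 from rfl]
    push_cast
    ring
  · intro n hn
    obtain ⟨k, rfl⟩ : ∃ k, d = n + 1 + k := ⟨d - (n + 1), by omega⟩
    have e1 : n + 1 + k - n = k + 1 := by omega
    simp only [e1, Nat.add_sub_cancel_left, Nat.factorial_succ, downCoeff,
      Fin.succ_zero_eq_one]
    push_cast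
    ring

end Eigenvalues

/-! ### Local solutions and Wronskians. -/

section Solutions

variable {Λ : PeriodPair} {l l' : Fin 4 → ℂ} {E x₀ : ℂ} {f : ℂ → ℂ} {F : Fin 2 → ℂ → ℂ}

lemma analyticOnNhd_potential (Λ : PeriodPair) (l : Fin 4 → ℂ) :
    AnalyticOnNhd ℂ (potential Λ l) (regularSet Λ) := fun x hx =>
  Finset.analyticAt_fun_sum _ fun i _ => analyticAt_const.mul <|
    AnalyticAt.fun_comp (f := fun x => x + halfPeriod Λ i)
      (Λ.analyticOnNhd_weierstrassP _ (add_halfPeriod_notMem hx i)) (by fun_prop)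

lemma potential_add_of_mem {w : ℂ} (hw : w ∈ Λ.lattice) (x : ℂ) :
    potential Λ l (x + w) = potential Λ l x := by
  simp only [potential, add_right_comm x w, weierstrassP_add_of_mem Λ _ hw]

lemma isSolutionAt_iff : IsSolutionAt Λ l E x₀ f ↔ AnalyticAt ℂ f x₀ ∧
    ∀ᶠ x in 𝓝 x₀, deriv (deriv f) x = (potential Λ l x - E) * f x := by
  refine and_congr_right fun _ => eventually_congr (Eventually.of_forall fun x => ?_)
  rw [hamiltonian, iteratedDeriv_two']
  constructor <;> intro h <;> linear_combination -h

/-- `f` is a holomorphic solution of `H f = E f` on `U`. -/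
def IsSolutionOn (Λ : PeriodPair) (l : Fin 4 → ℂ) (E : ℂ) (U : Set ℂ) (f : ℂ → ℂ) : Prop :=
  AnalyticOnNhd ℂ f U ∧ ∀ x ∈ U, deriv (deriv f) x = (potential Λ l x - E) * f x

lemma IsSolutionOn.isSolutionAt {U : Set ℂ} (h : IsSolutionOn Λ l E U f) (hU : IsOpen U)
    (hx : x₀ ∈ U) : IsSolutionAt Λ l E x₀ f :=
  isSolutionAt_iff.2 ⟨h.1 x₀ hx, (eventually_mem_set.2 (hU.mem_nhds hx)).mono h.2⟩

lemma exists_ball_isSolutionOn {s : Set ℂ} (hs : s ∈ 𝓝 x₀)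
    (hF : ∀ i, IsSolutionAt Λ l E x₀ (F i)) :
    ∃ r > 0, Metric.ball x₀ r ⊆ s ∧ ∀ i, IsSolutionOn Λ l E (Metric.ball x₀ r) (F i) := by
  have h1 : ∀ᶠ x in 𝓝 x₀, x ∈ s ∧ ∀ i, AnalyticAt ℂ (F i) x ∧
      deriv (deriv (F i)) x = (potential Λ l x - E) * F i x := by
    refine (eventually_mem_set.2 hs).and (eventually_all.2 fun i => ?_)
    have := isSolutionAt_iff.1 (hF i)
    exact this.1.eventually_analyticAt.and this.2
  obtain ⟨r, hr, hball⟩ := Metric.eventually_nhds_iff_ball.1 h1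
  exact ⟨r, hr, fun x hx => (hball x hx).1,
    fun i => ⟨fun x hx => ((hball x hx).2 i).1, fun x hx => ((hball x hx).2 i).2⟩⟩

lemma IsSolutionOn.add_mul {U : Set ℂ} {g : ℂ → ℂ} (hf : IsSolutionOn Λ l E U f)
    (hg : IsSolutionOn Λ l E U g) (hU : IsOpen U) (a b : ℂ) :
    IsSolutionOn Λ l E U (fun x => a * f x + b * g x) := by
  refine ⟨(analyticOnNhd_const.mul hf.1).add (analyticOnNhd_const.mul hg.1), fun x hx => ?_⟩
  have e : Set.EqOn (deriv fun x => a * f x + b * g x)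
      (fun x => a * deriv f x + b * deriv g x) U := fun y hy =>
    (((hf.1 y hy).differentiableAt.hasDerivAt.const_mul a).fun_add
      ((hg.1 y hy).differentiableAt.hasDerivAt.const_mul b)).deriv
  rw [e.deriv hU hx, (((hf.1 x hx).deriv.differentiableAt.hasDerivAt.const_mul a).fun_add
      ((hg.1 x hx).deriv.differentiableAt.hasDerivAt.const_mul b)).deriv, hf.2 x hx, hg.2 x hx]
  ring

lemma IsSolutionAt.add_mul {g : ℂ → ℂ} (hf : IsSolutionAt Λ l E x₀ f)
    (hg : IsSolutionAt Λ l E x₀ g) (a b : ℂ) :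
    IsSolutionAt Λ l E x₀ (fun x => a * f x + b * g x) := by
  obtain ⟨r, hr, -, h⟩ := exists_ball_isSolutionOn (F := ![f, g]) univ_mem
    (by intro i; fin_cases i <;> assumption)
  exact ((h 0).add_mul (h 1) Metric.isOpen_ball a b).isSolutionAt Metric.isOpen_ball
    (Metric.mem_ball_self hr)

/-- A solution is determined by its value and its derivative at a point. -/
lemma IsSolutionAt.eventuallyEq_zero (hx₀ : x₀ ∈ regularSet Λ) (hf : IsSolutionAt Λ l E x₀ f)
    (h0 : f x₀ = 0) (h1 : deriv f x₀ = 0) : f =ᶠ[𝓝 x₀] 0 := by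
  obtain ⟨ha, he⟩ := isSolutionAt_iff.1 hf
  have hV : AnalyticAt ℂ (fun x => potential Λ l x - E) x₀ :=
    (analyticOnNhd_potential Λ l x₀ hx₀).sub analyticAt_const
  have o1 := ha.analyticOrderAt_deriv_add_one
  have o2 := ha.deriv.analyticOrderAt_deriv_add_one
  -- The equation makes the order of `f''` at least that of `f`, whereas two differentiations lower
  -- a finite order by two.
  have o3 : analyticOrderAt (deriv (deriv f)) x₀ =
      analyticOrderAt (fun x => potential Λ l x - E) x₀ + analyticOrderAt f x₀ := by
    rw [← analyticOrderAt_mul hV ha]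
    exact analyticOrderAt_congr he
  simp only [h0, h1, sub_zero] at o1 o2
  refine analyticOrderAt_eq_top.1 ?_
  change analyticOrderAt (fun x => deriv f x) x₀ + 1 = analyticOrderAt (fun x => f x) x₀ at o1
  change _ + 1 = analyticOrderAt (deriv f) x₀ at o2
  by_contra hne
  change ¬ analyticOrderAt (fun x => f x) x₀ = ⊤ at hne
  change _ = _ + analyticOrderAt (fun x => f x) x₀ at o3
  rw [← o1, ← o2, o3] at hne
  generalize analyticOrderAt (fun x => f x) x₀ = n at *
  generalize analyticOrderAt (fun x => potential Λ l x - E) x₀ = k at *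
  have h3 : k + n + 1 + 1 = n := by rw [← o3, o2]; exact o1
  cases n with
  | top => simp at hne
  | coe n =>
    cases k with
    | top => simp at hne
    | coe k =>
      norm_cast at h3
      omega

/-- The Wronskian of two functions. -/
def wronskian (F : Fin 2 → ℂ → ℂ) (x : ℂ) : ℂ :=
  F 0 x * deriv (F 1) x - F 1 x * deriv (F 0) x

lemma exists_eq_zero_of_wronskian_eq_zero (hx₀ : x₀ ∈ regularSet Λ)
    (hF : ∀ i, IsSolutionAt Λ l E x₀ (F i)) (hW : wronskian F x₀ = 0) :
    ∃ a : Fin 2 → ℂ, a ≠ 0 ∧ (fun x => a 0 * F 0 x + a 1 * F 1 x) =ᶠ[𝓝 x₀] 0 := by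
  have hdet : (!![F 0 x₀, F 1 x₀; deriv (F 0) x₀, deriv (F 1) x₀] :
      Matrix (Fin 2) (Fin 2) ℂ).det = 0 := by
    rw [Matrix.det_fin_two_of]
    exact hW
  obtain ⟨a, ha, h⟩ := Matrix.exists_mulVec_eq_zero_iff.2 hdet
  have h0 := congrFun h 0
  have h1 := congrFun h 1
  simp [Matrix.mulVec, dotProduct, Fin.sum_univ_two] at h0 h1
  refine ⟨a, ha, ((hF 0).add_mul (hF 1) _ _).eventuallyEq_zero hx₀ ?_ ?_⟩
  · linear_combination h0
  · rw [(((hF 0).1.differentiableAt.hasDerivAt.const_mul (a 0)).fun_add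
      ((hF 1).1.differentiableAt.hasDerivAt.const_mul (a 1))).deriv]
    linear_combination h1

/-- Uniqueness for given Cauchy data suffices: Cramer's rule matches the data of any solution with a
combination of the two given ones. -/
lemma isSolutionBasisAt_iff (hx₀ : x₀ ∈ regularSet Λ) (hF : ∀ i, IsSolutionAt Λ l E x₀ (F i)) :
    IsSolutionBasisAt Λ l E x₀ F ↔ wronskian F x₀ ≠ 0 := by
  have hd := fun i => (hF i).1.differentiableAt.hasDerivAt
  constructor
  · rintro ⟨-, hb⟩ hW
    obtain ⟨a, ha, h⟩ := exists_eq_zero_of_wronskian_eq_zero hx₀ hF hW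
    have hz : IsSolutionAt Λ l E x₀ 0 := by
      have := (hF 0).add_mul (hF 1) 0 0
      simpa using! this
    obtain ⟨b, -, hb⟩ := hb 0 hz
    have e1 := hb a (by
      simp only [Fin.sum_univ_two]
      exact h.symm)
    have e2 := hb 0 (by simp; rfl)
    exact ha (e1.trans e2.symm)
  · intro hW
    refine ⟨hF, fun h hh => ?_⟩
    have hdh := hh.1.differentiableAt.hasDerivAt
    have key : ∀ a : Fin 2 → ℂ, h =ᶠ[𝓝 x₀] (fun x => ∑ i, a i * F i x) →
        a 0 * F 0 x₀ + a 1 * F 1 x₀ = h x₀ ∧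
          a 0 * deriv (F 0) x₀ + a 1 * deriv (F 1) x₀ = deriv h x₀ := by
      intro a ha
      simp only [Fin.sum_univ_two] at ha
      exact ⟨ha.eq_of_nhds.symm, by
        rw [ha.deriv_eq, (((hd 0).const_mul (a 0)).fun_add ((hd 1).const_mul (a 1))).deriv]⟩
    rw [wronskian] at hW
    have huniq : ∀ a b : Fin 2 → ℂ, h =ᶠ[𝓝 x₀] (fun x => ∑ i, a i * F i x) →
        h =ᶠ[𝓝 x₀] (fun x => ∑ i, b i * F i x) → a = b := by
      intro a b ha hb
      obtain ⟨a0, a1⟩ := key a ha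
      obtain ⟨b0, b1⟩ := key b hb
      ext i
      apply mul_left_cancel₀ hW
      fin_cases i
      · simp only [Fin.zero_eta]
        linear_combination (a0 - b0) * deriv (F 1) x₀ - (a1 - b1) * F 1 x₀
      · simp only [Fin.mk_one]
        linear_combination (a1 - b1) * F 0 x₀ - (a0 - b0) * deriv (F 0) x₀
    set a : Fin 2 → ℂ := ![(h x₀ * deriv (F 1) x₀ - F 1 x₀ * deriv h x₀) /
        (F 0 x₀ * deriv (F 1) x₀ - F 1 x₀ * deriv (F 0) x₀),
      (F 0 x₀ * deriv h x₀ - h x₀ * deriv (F 0) x₀) /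
        (F 0 x₀ * deriv (F 1) x₀ - F 1 x₀ * deriv (F 0) x₀)] with ha
    have a0 : a 0 * F 0 x₀ + a 1 * F 1 x₀ = h x₀ := by
      simp only [ha, Matrix.cons_val_zero, Matrix.cons_val_one]
      rw [div_mul_eq_mul_div, div_mul_eq_mul_div, ← add_div, div_eq_iff hW]
      ring
    have a1 : a 0 * deriv (F 0) x₀ + a 1 * deriv (F 1) x₀ = deriv h x₀ := by
      simp only [ha, Matrix.cons_val_zero, Matrix.cons_val_one]
      rw [div_mul_eq_mul_div, div_mul_eq_mul_div, ← add_div, div_eq_iff hW]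
      ring
    have hsol := (hh.add_mul ((hF 0).add_mul (hF 1) (a 0) (a 1)) 1 (-1)).eventuallyEq_zero hx₀
      (by rw [a0]; ring) (by
        rw [((hdh.const_mul 1).fun_add ((((hd 0).const_mul (a 0)).fun_add
          ((hd 1).const_mul (a 1))).const_mul (-1))).deriv, a1]
        ring)
    have hex : h =ᶠ[𝓝 x₀] fun x => ∑ i, a i * F i x := by
      filter_upwards [hsol] with x hx
      simp only [Fin.sum_univ_two, Pi.zero_apply] at hx ⊢
      linear_combination hx
    exact ⟨a, hex, fun b hb => huniq b a hb hex⟩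

end Solutions

/-! ### The operator `L` on solutions, as an invertible first order operator. -/

section Reduction

variable {Λ : PeriodPair} {l : Fin 4 → ℂ} {E : ℂ} {U : Set ℂ} {f : ℂ → ℂ} {n : ℕ}

/-- The coefficients of `f` and `f'` in the `k`-th derivative of a solution `f` of `H f = E f`. -/
def jetCoeff (Λ : PeriodPair) (l : Fin 4 → ℂ) (E : ℂ) : ℕ → (ℂ → ℂ) × (ℂ → ℂ)
  | 0 => (fun _ => 1, fun _ => 0)
  | k + 1 => (fun x => deriv (jetCoeff Λ l E k).1 x +
      (jetCoeff Λ l E k).2 x * (potential Λ l x - E),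
    fun x => (jetCoeff Λ l E k).1 x + deriv (jetCoeff Λ l E k).2 x)

lemma jetCoeff_analyticOnNhd (Λ : PeriodPair) (l : Fin 4 → ℂ) (E : ℂ) (k : ℕ) :
    AnalyticOnNhd ℂ (jetCoeff Λ l E k).1 (regularSet Λ) ∧
      AnalyticOnNhd ℂ (jetCoeff Λ l E k).2 (regularSet Λ) := by
  induction k with
  | zero => exact ⟨analyticOnNhd_const, analyticOnNhd_const⟩
  | succ k ih =>
    exact ⟨ih.1.deriv.add (ih.2.mul ((analyticOnNhd_potential Λ l).sub analyticOnNhd_const)),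
      ih.1.add ih.2.deriv⟩

lemma jetCoeff_add_of_mem {w : ℂ} (hw : w ∈ Λ.lattice) (k : ℕ) :
    (∀ x, (jetCoeff Λ l E k).1 (x + w) = (jetCoeff Λ l E k).1 x) ∧
      ∀ x, (jetCoeff Λ l E k).2 (x + w) = (jetCoeff Λ l E k).2 x := by
  induction k with
  | zero => exact ⟨fun _ => rfl, fun _ => rfl⟩
  | succ k ih =>
    exact ⟨fun x => by simp only [jetCoeff, deriv_add_of_periodic ih.1, ih.2,
        potential_add_of_mem hw],
      fun x => by simp only [jetCoeff, deriv_add_of_periodic ih.2, ih.1]⟩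

lemma IsSolutionOn.iteratedDeriv_eq (h : IsSolutionOn Λ l E U f) (hU : IsOpen U)
    (hUD : U ⊆ regularSet Λ) (k : ℕ) :
    Set.EqOn (iteratedDeriv k f) (fun x => (jetCoeff Λ l E k).1 x * f x +
      (jetCoeff Λ l E k).2 x * deriv f x) U := by
  induction k with
  | zero => intro x _; simp [jetCoeff]
  | succ k ih =>
    intro x hx
    obtain ⟨h1, h2⟩ := jetCoeff_analyticOnNhd Λ l E k
    rw [iteratedDeriv_succ, ih.deriv hU hx,
      (((h1 x (hUD hx)).differentiableAt.hasDerivAt.fun_mul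
        (h.1 x hx).differentiableAt.hasDerivAt).fun_add
        ((h2 x (hUD hx)).differentiableAt.hasDerivAt.fun_mul
          (h.1 x hx).deriv.differentiableAt.hasDerivAt)).deriv, h.2 x hx]
    simp only [jetCoeff]
    ring

/-- The coefficient of `f` in `L f`, for solutions `f` of `H f = E f`. -/
def actCoeff₀ (l : Fin 4 → ℂ) (E : ℂ) (L : MonicDiffOp (regularSet Λ) n) (x : ℂ) : ℂ :=
  (jetCoeff Λ l E n).1 x + ∑ k : Fin n, L.coeff k x * (jetCoeff Λ l E k).1 x

/-- The coefficient of `f'` in `L f`, for solutions `f` of `H f = E f`. -/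
def actCoeff₁ (l : Fin 4 → ℂ) (E : ℂ) (L : MonicDiffOp (regularSet Λ) n) (x : ℂ) : ℂ :=
  (jetCoeff Λ l E n).2 x + ∑ k : Fin n, L.coeff k x * (jetCoeff Λ l E k).2 x

/-- The determinant of the map `(f, f') ↦ (L f, (L f)')` on solutions `f` of `H f = E f`. -/
def actDet (l : Fin 4 → ℂ) (E : ℂ) (L : MonicDiffOp (regularSet Λ) n) (x : ℂ) : ℂ :=
  actCoeff₀ l E L x * (actCoeff₀ l E L x + deriv (actCoeff₁ l E L) x) -
    actCoeff₁ l E L x * (deriv (actCoeff₀ l E L) x + actCoeff₁ l E L x * (potential Λ l x - E))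

variable {L : MonicDiffOp (regularSet Λ) n}

lemma actCoeff₀_analyticOnNhd : AnalyticOnNhd ℂ (actCoeff₀ l E L) (regularSet Λ) := fun x hx =>
  ((jetCoeff_analyticOnNhd Λ l E n).1 x hx).add <| Finset.analyticAt_fun_sum _ fun k _ =>
    (L.analytic k x hx).mul ((jetCoeff_analyticOnNhd Λ l E k).1 x hx)

lemma actCoeff₁_analyticOnNhd : AnalyticOnNhd ℂ (actCoeff₁ l E L) (regularSet Λ) := fun x hx =>
  ((jetCoeff_analyticOnNhd Λ l E n).2 x hx).add <| Finset.analyticAt_fun_sum _ fun k _ =>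
    (L.analytic k x hx).mul ((jetCoeff_analyticOnNhd Λ l E k).2 x hx)

lemma actDet_analyticOnNhd : AnalyticOnNhd ℂ (actDet l E L) (regularSet Λ) :=
  (actCoeff₀_analyticOnNhd.mul (actCoeff₀_analyticOnNhd.add actCoeff₁_analyticOnNhd.deriv)).sub
    (actCoeff₁_analyticOnNhd.mul (actCoeff₀_analyticOnNhd.deriv.add
      (actCoeff₁_analyticOnNhd.mul ((analyticOnNhd_potential Λ l).sub analyticOnNhd_const))))

lemma act_analyticAt {x : ℂ} (hx : x ∈ regularSet Λ) (hf : AnalyticAt ℂ f x) :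
    AnalyticAt ℂ (L.act f) x := by
  have hit : ∀ k, AnalyticAt ℂ (iteratedDeriv k f) x := fun k => by
    rw [iteratedDeriv_eq_iterate]; exact hf.iterated_deriv k
  exact (hit n).add (Finset.analyticAt_fun_sum _ fun k _ => (L.analytic k x hx).mul (hit k))

lemma act_congr {x : ℂ} {g : ℂ → ℂ} (h : f =ᶠ[𝓝 x] g) : L.act f =ᶠ[𝓝 x] L.act g := by
  filter_upwards [h.eventuallyEq_nhds] with y hy
  simp only [MonicDiffOp.act, hy.iteratedDeriv_eq]

lemma IsSolutionOn.act_eq (h : IsSolutionOn Λ l E U f) (hU : IsOpen U)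
    (hUD : U ⊆ regularSet Λ) :
    Set.EqOn (L.act f) (fun x => actCoeff₀ l E L x * f x + actCoeff₁ l E L x * deriv f x) U := by
  intro x hx
  change L.act f x = actCoeff₀ l E L x * f x + actCoeff₁ l E L x * deriv f x
  rw [actCoeff₀, actCoeff₁, _root_.add_mul, _root_.add_mul, Finset.sum_mul, Finset.sum_mul]
  simp only [MonicDiffOp.act, h.iteratedDeriv_eq hU hUD _ hx, mul_add, Finset.sum_add_distrib,
    mul_assoc]
  ring

lemma IsSolutionOn.deriv_act_eq (h : IsSolutionOn Λ l E U f) (hU : IsOpen U)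
    (hUD : U ⊆ regularSet Λ) :
    Set.EqOn (deriv (L.act f)) (fun x => (deriv (actCoeff₀ l E L) x +
      actCoeff₁ l E L x * (potential Λ l x - E)) * f x +
      (actCoeff₀ l E L x + deriv (actCoeff₁ l E L) x) * deriv f x) U := by
  intro x hx
  rw [(h.act_eq hU hUD).deriv hU hx,
    (((actCoeff₀_analyticOnNhd x (hUD hx)).differentiableAt.hasDerivAt.fun_mul
      (h.1 x hx).differentiableAt.hasDerivAt).fun_add
      ((actCoeff₁_analyticOnNhd x (hUD hx)).differentiableAt.hasDerivAt.fun_mul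
        (h.1 x hx).deriv.differentiableAt.hasDerivAt)).deriv, h.2 x hx]
  ring

lemma wronskian_act {F : Fin 2 → ℂ → ℂ} (hF : ∀ i, IsSolutionOn Λ l E U (F i)) (hU : IsOpen U)
    (hUD : U ⊆ regularSet Λ) :
    Set.EqOn (wronskian fun i => L.act (F i)) (fun x => actDet l E L x * wronskian F x) U := by
  intro x hx
  simp only [wronskian, (hF _).act_eq hU hUD hx, (hF _).deriv_act_eq hU hUD hx, actDet]
  ring

lemma deriv_wronskian {F : Fin 2 → ℂ → ℂ} (hF : ∀ i, IsSolutionOn Λ l E U (F i)) {x : ℂ}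
    (hx : x ∈ U) : HasDerivAt (wronskian F) 0 x := by
  have h := fun i => ((hF i).1 x hx).differentiableAt.hasDerivAt
  have h' := fun i => ((hF i).1 x hx).deriv.differentiableAt.hasDerivAt
  refine (((h 0).fun_mul (h' 1)).fun_sub ((h 1).fun_mul (h' 0))).congr_deriv ?_
  rw [(hF 0).2 x hx, (hF 1).2 x hx]
  ring

lemma wronskian_eq {F : Fin 2 → ℂ → ℂ} (hF : ∀ i, IsSolutionOn Λ l E U (F i)) (hU : IsOpen U)
    (hc : IsPreconnected U) {x y : ℂ} (hx : x ∈ U) (hy : y ∈ U) :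
    wronskian F x = wronskian F y := by
  obtain ⟨c, h⟩ := hU.exists_is_const_of_deriv_eq_zero hc
    (fun x hx => (deriv_wronskian hF hx).differentiableAt.differentiableWithinAt)
    (fun x hx => (deriv_wronskian hF hx).deriv)
  rw [h x hx, h y hy]

/-- `actDet` is constant if `L` maps solutions of one equation to solutions of another. -/
lemma actDet_eq_const {l' : Fin 4 → ℂ} {F : Fin 2 → ℂ → ℂ} {x₀ : ℂ} (hx₀ : x₀ ∈ regularSet Λ)
    (hF : IsSolutionBasisAt Λ l E x₀ F)
    (hLF : IsSolutionBasisAt Λ l' E x₀ fun i => L.act (F i)) :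
    ∃ δ : ℂ, δ ≠ 0 ∧ ∀ x ∈ regularSet Λ, actDet l E L x = δ := by
  have hW := (isSolutionBasisAt_iff hx₀ hF.1).1 hF
  have hW' := (isSolutionBasisAt_iff hx₀ hLF.1).1 hLF
  obtain ⟨r, hr, hrD, hr1⟩ := exists_ball_isSolutionOn ((isOpen_regularSet Λ).mem_nhds hx₀) hF.1
  obtain ⟨r', hr', hrD', hr1'⟩ := exists_ball_isSolutionOn (Metric.ball_mem_nhds x₀ hr) hLF.1
  have hx : x₀ ∈ Metric.ball x₀ r := Metric.mem_ball_self hr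
  have hx' : x₀ ∈ Metric.ball x₀ r' := Metric.mem_ball_self hr'
  refine ⟨actDet l E L x₀, ?_, ?_⟩
  · rw [wronskian_act hr1 Metric.isOpen_ball hrD hx] at hW'
    exact left_ne_zero_of_mul hW'
  -- Near `x₀` the determinant is a quotient of two constant Wronskians; the identity theorem
  -- extends its constancy to the whole regular set.
  · refine actDet_analyticOnNhd.eqOn_of_preconnected_of_eventuallyEq analyticOnNhd_const
      (isConnected_regularSet Λ).isPreconnected hx₀ ?_
    filter_upwards [Metric.isOpen_ball.mem_nhds hx'] with y hy
    have h1 : _ = actDet l E L y * wronskian F y :=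
      wronskian_act hr1 Metric.isOpen_ball hrD (hrD' hy) (L := L)
    have h2 : _ = actDet l E L x₀ * wronskian F x₀ :=
      wronskian_act hr1 Metric.isOpen_ball hrD hx (L := L)
    rw [wronskian_eq hr1' Metric.isOpen_ball (convex_ball x₀ r').isPreconnected hy hx', h2,
      wronskian_eq hr1 Metric.isOpen_ball (convex_ball x₀ r).isPreconnected (hrD' hy) hx] at h1
    exact (mul_right_cancel₀ hW h1).symm

/-- The inverse of `L` on solutions of `H f = E f`, as a first order operator. -/
def actInv (l : Fin 4 → ℂ) (E : ℂ) (L : MonicDiffOp (regularSet Λ) n) (δ : ℂ) (g : ℂ → ℂ)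
    (x : ℂ) : ℂ :=
  ((actCoeff₀ l E L x + deriv (actCoeff₁ l E L) x) * g x - actCoeff₁ l E L x * deriv g x) / δ

lemma actInv_analyticAt {δ x : ℂ} (hx : x ∈ regularSet Λ) (hf : AnalyticAt ℂ f x) :
    AnalyticAt ℂ (actInv l E L δ f) x :=
  ((((actCoeff₀_analyticOnNhd x hx).add (actCoeff₁_analyticOnNhd x hx).deriv).mul hf).sub
    ((actCoeff₁_analyticOnNhd x hx).mul hf.deriv)).div_const

lemma actInv_congr {δ x : ℂ} {g : ℂ → ℂ} (h : f =ᶠ[𝓝 x] g) :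
    actInv l E L δ f =ᶠ[𝓝 x] actInv l E L δ g := by
  filter_upwards [h, h.deriv] with y hy hy'
  simp only [actInv, hy, hy']

/-- Cramer's rule for the linear system expressing `(L f, (L f)')` through `(f, f')`. -/
lemma IsSolutionOn.actInv_act {δ : ℂ} (h : IsSolutionOn Λ l E U f) (hU : IsOpen U)
    (hUD : U ⊆ regularSet Λ) (hδ : δ ≠ 0) (hdet : ∀ x ∈ regularSet Λ, actDet l E L x = δ) :
    Set.EqOn (actInv l E L δ (L.act f)) f U := by
  intro x hx
  rw [actInv, h.act_eq hU hUD hx, h.deriv_act_eq hU hUD hx, div_eq_iff hδ, ← hdet x (hUD hx),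
    actDet]
  ring

end Reduction

/-! ### Transport of monodromy matrices. -/

section Monodromy

variable {Λ : PeriodPair} {l l' : Fin 4 → ℂ} {E x₀ : ℂ} {F : Fin 2 → ℂ → ℂ} {n : ℕ}
  {L : MonicDiffOp (regularSet Λ) n}

/-- An operator that acts on germs and preserves analyticity can be applied to every germ of a
continuation. It serves for both `L.act` and `actInv`. -/
lemma ContinuesAlong.map {a b : ℂ} {γ : Path a b} {f h : ℂ → ℂ} {D : Set ℂ}
    {T : (ℂ → ℂ) → ℂ → ℂ} (H : ContinuesAlong γ f h) (hγ : ∀ t, γ t ∈ D)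
    (hT : ∀ g, ∀ x ∈ D, AnalyticAt ℂ g x → AnalyticAt ℂ (T g) x)
    (hTc : ∀ g₁ g₂ : ℂ → ℂ, ∀ x, g₁ =ᶠ[𝓝 x] g₂ → T g₁ =ᶠ[𝓝 x] T g₂) :
    ContinuesAlong γ (T f) (T h) := by
  obtain ⟨G, hG, hloc, h0, h1⟩ := H
  exact ⟨fun t => T (G t), fun t => hT _ _ (hγ t) (hG t),
    fun t => (hloc t).mono fun s hs => hTc _ _ _ hs, hTc _ _ _ h0, hTc _ _ _ h1⟩

lemma ContinuesAlong.congr {a b : ℂ} {γ : Path a b} {f f' h h' : ℂ → ℂ}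
    (H : ContinuesAlong γ f h) (hf : f =ᶠ[𝓝 a] f') (hh : h =ᶠ[𝓝 b] h') :
    ContinuesAlong γ f' h' := by
  obtain ⟨G, hG, hloc, h0, h1⟩ := H
  exact ⟨G, hG, hloc, h0.trans hf, h1.trans hh⟩

lemma eventually_sub_of_eventually {p : ℂ → Prop} {ω : ℂ} (h : ∀ᶠ x in 𝓝 x₀, p x) :
    ∀ᶠ y in 𝓝 (x₀ + ω), p (y - ω) := by
  have : Tendsto (fun y => y - ω) (𝓝 (x₀ + ω)) (𝓝 x₀) := by
    have h1 : Continuous fun y : ℂ => y - ω := by fun_prop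
    simpa using h1.tendsto (x₀ + ω)
  exact this h

lemma iteratedDeriv_sum_sub {ω y : ℂ} (hF : ∀ i, AnalyticAt ℂ (F i) (y - ω)) (a : Fin 2 → ℂ)
    (k : ℕ) :
    iteratedDeriv k (fun y => ∑ i, a i * F i (y - ω)) y =
      ∑ i, a i * iteratedDeriv k (F i) (y - ω) := by
  have hsh : ∀ i, AnalyticAt ℂ (fun y => a i * F i (y - ω)) y := fun i =>
    analyticAt_const.mul (AnalyticAt.fun_comp (f := fun y => y - ω) (hF i) (by fun_prop))
  rw [iteratedDeriv_fun_sum fun i _ => (hsh i).contDiffAt]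
  simp only [iteratedDeriv_const_mul_field, iteratedDeriv_comp_sub_const]

lemma act_sum_sub {ω y : ℂ} (hL : ∀ k, L.coeff k y = L.coeff k (y - ω))
    (hF : ∀ i, AnalyticAt ℂ (F i) (y - ω)) (a : Fin 2 → ℂ) :
    L.act (fun y => ∑ i, a i * F i (y - ω)) y = ∑ i, a i * L.act (F i) (y - ω) := by
  simp only [MonicDiffOp.act, iteratedDeriv_sum_sub hF, hL]
  simp only [Fin.sum_univ_two, mul_add, Finset.sum_add_distrib, Finset.mul_sum,
    mul_left_comm (a _)]

lemma actCoeff_add_of_mem {ω : ℂ} (hω : ω ∈ Λ.lattice)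
    (hL : ∀ k x, L.coeff k (x + ω) = L.coeff k x) :
    (∀ x, actCoeff₀ l E L (x + ω) = actCoeff₀ l E L x) ∧
      ∀ x, actCoeff₁ l E L (x + ω) = actCoeff₁ l E L x := by
  constructor <;> intro x
  · simp only [actCoeff₀, hL, (jetCoeff_add_of_mem hω _).1]
  · simp only [actCoeff₁, hL, (jetCoeff_add_of_mem hω _).2]

lemma actInv_sum_sub {ω y δ : ℂ} (hω : ω ∈ Λ.lattice)
    (hL : ∀ k x, L.coeff k (x + ω) = L.coeff k x)
    (hF : ∀ i, AnalyticAt ℂ (F i) (y - ω)) (a : Fin 2 → ℂ) :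
    actInv l E L δ (fun y => ∑ i, a i * F i (y - ω)) y =
      ∑ i, a i * actInv l E L δ (F i) (y - ω) := by
  obtain ⟨h0, h1⟩ := actCoeff_add_of_mem (l := l) (E := E) hω hL
  have e0 := h0 (y - ω)
  have e1 := h1 (y - ω)
  have e2 := deriv_add_of_periodic h1 (y - ω)
  have e3 := iteratedDeriv_sum_sub hF a 1
  simp only [sub_add_cancel, iteratedDeriv_one] at e0 e1 e2 e3
  simp only [actInv, e0, e1, e2, e3]
  simp only [Fin.sum_univ_two]
  ring

/-- `L` and its inverse on solutions are local and linear, and they commute with translation by `ω`.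
In the converse direction, inversion needs checking only near the two endpoints, where the germs are
combinations of the `L.act (F i)`. -/
lemma isMonodromyMatrix_act_iff {l' : Fin 4 → ℂ} (hx₀ : x₀ ∈ regularSet Λ)
    (hF : IsSolutionBasisAt Λ l E x₀ F)
    (hLF : IsSolutionBasisAt Λ l' E x₀ fun i => L.act (F i)) {ω : ℂ} (hω : ω ∈ Λ.lattice)
    (hL : ∀ k x, L.coeff k (x + ω) = L.coeff k x) (γ : Path x₀ (x₀ + ω))
    (hγ : ∀ t, γ t ∈ regularSet Λ) (A : Matrix (Fin 2) (Fin 2) ℂ) :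
    IsMonodromyMatrix γ F A ↔ IsMonodromyMatrix γ (fun i => L.act (F i)) A := by
  obtain ⟨δ, hδ, hdet⟩ := actDet_eq_const hx₀ hF hLF
  obtain ⟨r, hr, hrD, hr1⟩ := exists_ball_isSolutionOn ((isOpen_regularSet Λ).mem_nhds hx₀) hF.1
  have hball : ∀ᶠ y in 𝓝 (x₀ + ω), y - ω ∈ Metric.ball x₀ r :=
    eventually_sub_of_eventually (eventually_mem_set.2 (Metric.ball_mem_nhds x₀ hr))
  have hform : ∀ j, (fun y => ∑ i, F i (y - ω) * A i j) =
      fun y => ∑ i, A i j * F i (y - ω) := fun j => by simp only [mul_comm]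
  have hform' : ∀ j, (fun y => ∑ i, L.act (F i) (y - ω) * A i j) =
      fun y => ∑ i, A i j * L.act (F i) (y - ω) := fun j => by simp only [mul_comm]
  simp only [IsMonodromyMatrix, hform, hform']
  refine forall_congr' fun j => ⟨fun H => ?_, fun H => ?_⟩
  · refine (H.map hγ (T := L.act) (fun g x hx hg => act_analyticAt hx hg)
      fun g₁ g₂ x h => act_congr h).congr EventuallyEq.rfl ?_
    filter_upwards [hball] with y hy
    exact act_sum_sub (fun k => by rw [← hL k (y - ω), sub_add_cancel])
      (fun i => (hr1 i).1 _ hy) fun i => A i j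
  · refine (H.map hγ (T := actInv l E L δ) (fun g x hx hg => actInv_analyticAt hx hg)
      fun g₁ g₂ x h => actInv_congr h).congr ?_ ?_
    · filter_upwards [Metric.ball_mem_nhds x₀ hr] with y hy
      exact (hr1 j).actInv_act Metric.isOpen_ball hrD hδ hdet hy
    · filter_upwards [hball] with y hy
      rw [actInv_sum_sub hω hL (fun i => act_analyticAt (hrD hy) ((hr1 i).1 _ hy))]
      refine Finset.sum_congr rfl fun i _ => ?_
      rw [(hr1 i).actInv_act Metric.isOpen_ball hrD hδ hdet hy]

end Monodromy

/-! ### Isomonodromy away from the exceptional values. -/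

section Isomonodromic

variable {Λ : PeriodPair} {l α : Fin 4 → ℂ} {d : ℕ} {E x₀ : ℂ} {F : Fin 2 → ℂ → ℂ}

/-- A solution in the kernel of the annihilator lies in `V_α`. -/
lemma isEigenvalueOnSpace_of_act_eventuallyEq_zero {f : ℂ → ℂ} (hx₀ : x₀ ∈ regularSet Λ)
    (hf : IsSolutionAt Λ l E x₀ f) (hne : ¬ f =ᶠ[𝓝 x₀] 0)
    (h0 : (annihilator Λ (fun i => α i.succ) (d + 1)).act f =ᶠ[𝓝 x₀] 0) :
    IsEigenvalueOnSpace Λ l α d E := by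
  obtain ⟨r, hr, Φ, hUD, hs, hΦ⟩ := exists_isBranch α hx₀
    (h0.and (hf.1.eventually_analyticAt.and hf.2))
  have hU := Metric.isOpen_ball (x := x₀) (ε := r)
  have hxU : x₀ ∈ Metric.ball x₀ r := Metric.mem_ball_self hr
  have hfa : AnalyticOnNhd ℂ f (Metric.ball x₀ r) := fun x hx => (hs hx).2.1
  obtain ⟨p, hp, hpf⟩ := exists_eq_gauge_eval_of_ladder_eq_zero (hΦ.isGauge hU hUD) hU
    (convex_ball x₀ r).isPreconnected hUD (d + 1) f hfa (fun x hx => by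
      rw [← act_annihilator hU hUD hfa _ hx]
      exact (hs hx).1)
  refine ⟨_, Φ, hU, (convex_ball x₀ r).isConnected ⟨x₀, hxU⟩, hUD, hΦ, _,
    mem_quasiSolvableSpace_iff.2 ⟨p, hp, rfl⟩, ?_, fun x hx => ?_⟩
  · by_contra! H
    refine hne ?_
    filter_upwards [hU.mem_nhds hxU] with x hx
    rw [hpf hx]
    exact H x hx
  · have h := (hs hx).2.2
    rw [hamiltonian, hpf.iteratedDeriv_of_isOpen hU 2 hx, hpf hx] at h
    exact h

/-- Were the image Wronskian zero, a nontrivial combination of the basis would be killed by `L`,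
hence would lie in `V_α` and make `E` an eigenvalue. -/
lemma isIsomonodromicAt (h : ∀ i, l i * (l i + 1) = α i * (α i - 1))
    (hd : (d : ℂ) = -(∑ i, α i) / 2) (hE : ¬ IsEigenvalueOnSpace Λ l α d E) :
    IsIsomonodromicAt Λ l (fun i => α i + d) (annihilator Λ (fun i => α i.succ) (d + 1)) E := by
  intro x₀ hx₀ F hF
  set L := annihilator Λ (fun i => α i.succ) (d + 1) with hL
  obtain ⟨r, hr, hrD, hr1⟩ := exists_ball_isSolutionOn ((isOpen_regularSet Λ).mem_nhds hx₀) hF.1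
  have hU := Metric.isOpen_ball (x := x₀) (ε := r)
  have hxU : x₀ ∈ Metric.ball x₀ r := Metric.mem_ball_self hr
  have hsol : ∀ i, IsSolutionAt Λ (fun i => α i + d) E x₀ (L.act (F i)) := by
    intro i
    refine ⟨act_analyticAt hx₀ (hF.1 i).1, ?_⟩
    filter_upwards [hU.mem_nhds hxU, (hF.1 i).2.eventually_nhds] with x hx hHx
    rw [intertwining h hd hU hrD (hr1 i).1 hx]
    have hHx' : hamiltonian Λ l (F i) =ᶠ[𝓝 x] fun y => E * F i y := hHx
    rw [(act_congr (L := L) hHx').eq_of_nhds]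
    simp only [MonicDiffOp.act, iteratedDeriv_const_mul_field, mul_add, Finset.mul_sum,
      mul_left_comm]
  have hbasis : IsSolutionBasisAt Λ (fun i => α i + d) E x₀ (fun i => L.act (F i)) := by
    rw [isSolutionBasisAt_iff hx₀ hsol]
    intro hW
    obtain ⟨a, ha, hz⟩ := exists_eq_zero_of_wronskian_eq_zero hx₀ hsol hW
    refine hE (isEigenvalueOnSpace_of_act_eventuallyEq_zero hx₀
      ((hF.1 0).add_mul (hF.1 1) (a 0) (a 1)) (fun H => ?_) ?_)
    · have hWF := (isSolutionBasisAt_iff hx₀ hF.1).1 hF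
      obtain ⟨b, -, hb⟩ := hF.2 _ ((hF.1 0).add_mul (hF.1 1) (a 0) (a 1))
      have e1 := hb a (by simp only [Fin.sum_univ_two]; exact EventuallyEq.rfl)
      have e2 := hb 0 (by
        filter_upwards [H] with y hy
        rw [hy]
        simp)
      exact ha (e1.trans e2.symm)
    · refine EventuallyEq.trans ?_ hz
      filter_upwards [hU.mem_nhds hxU] with y hy
      -- The zero translation reduces this to plain linearity of `L`.
      have := act_sum_sub (L := L) (F := F) (ω := 0) (y := y) (fun k => by rw [sub_zero])
        (fun i => by rw [sub_zero]; exact (hr1 i).1 y hy) a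
      simpa only [sub_zero, Fin.sum_univ_two] using this
  refine ⟨hbasis, fun ω hω γ hγ A => ?_⟩
  exact isMonodromyMatrix_act_iff hx₀ hF hbasis hω
    (fun k x => ladderCoeff_add_of_mem hω _ _ x) γ hγ A

end Isomonodromic

end Heun

end

theorem mainTheorem1 (Λ : PeriodPair) (l α : Fin 4 → ℂ) (d : ℕ)
    (hα : ∀ i, α i = -l i ∨ α i = l i + 1)
    (hd : (d : ℂ) = -(∑ i, α i) / 2) :
    Heun.PreservesSpace Λ l α d ∧
    (∃ L : Heun.MonicDiffOp (Heun.regularSet Λ) (d + 1),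
      -- `L` is the unique monic operator of order `d + 1` annihilating `V_α`
      Heun.AnnihilatesSpace Λ α d L ∧
      (∀ L' : Heun.MonicDiffOp (Heun.regularSet Λ) (d + 1), Heun.AnnihilatesSpace Λ α d L' →
        ∀ k, Set.EqOn (L'.coeff k) (L.coeff k) (Heun.regularSet Λ)) ∧
      -- its coefficients are meromorphic and doubly periodic
      (∀ k, Meromorphic (L.coeff k)) ∧
      (∀ k, ∀ x ∈ Heun.regularSet Λ, ∀ ω ∈ Λ.lattice, L.coeff k (x + ω) = L.coeff k x) ∧
      -- it intertwines the two operators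
      (∀ (U : Set ℂ) (f : ℂ → ℂ), IsOpen U → U ⊆ Heun.regularSet Λ → AnalyticOnNhd ℂ f U →
        ∀ x ∈ U, Heun.hamiltonian Λ (fun i => α i + d) (L.act f) x =
          L.act (Heun.hamiltonian Λ l f) x) ∧
      -- it is an isomonodromic transformation
      (∀ E : ℂ, ¬ Heun.IsEigenvalueOnSpace Λ l α d E →
        Heun.IsIsomonodromicAt Λ l (fun i => α i + d) L E)) ∧
    -- the exceptional values of `E` correspond to each other
    (∀ E : ℂ, Heun.IsEigenvalueOnSpace Λ l α d E ↔
      Heun.IsEigenvalueOnSpace Λ (fun i => α i + d) (fun i => -α i - d) d E) := by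
  -- The potential sees the exponents only through this product, which is the same for both choices
  -- of `αᵢ`.
  have h : ∀ i, l i * (l i + 1) = α i * (α i - 1) := by
    intro i
    rcases hα i with hi | hi <;> rw [hi] <;> ring
  refine ⟨Heun.preservesSpace h hd, ⟨Heun.annihilator Λ (fun i => α i.succ) (d + 1),
    Heun.annihilatesSpace_annihilator Λ α d,
    fun L' hL' k => (Heun.annihilatesSpace_annihilator Λ α d).eqOn_coeff hL' k,
    fun k => Heun.ladderCoeff_meromorphic _ _ _ _,
    fun k x _ ω hω => Heun.ladderCoeff_add_of_mem hω _ _ x,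
    fun U f hU hUD hf => Heun.intertwining h hd hU hUD hf,
    fun E hE => Heun.isIsomonodromicAt h hd hE⟩, Heun.isEigenvalueOnSpace_iff_dual h hd⟩
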